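/- Let $L\ge 0$, let $M_0,\dots,M_L\ge 1$ be integers, and write $[M]=\{1,\dots,M\}$. For $J\in\mathbb Z$ and a signal $x(u,\lambda)$, $u\in\mathbb R^2$, $\lambda\in[M]$, with $x(\cdot,\lambda)\in L^2(\mathbb R^2)$ for all $\lambda$, put $$\|x\|^2=\frac1M\sum_{\lambda\in[M]}\frac1{|\Omega|}\int_{\mathbb R^2}|x(u,\lambda)|^2\,du,\qquad |\Omega|=(2\cdot 2^J)^2 .$$ *Fourier–Bessel (FB) basis.* Let $J_m$ be the Bessel function of the first kind of order $m$ and $R_{m,q}$ its $q$-th positive zero ($m=0,1,2,\dots$, $q=1,2,\dots$). The real FB basis functions $\psi_k$ are the real and imaginary parts of $J_m(R_{m,q}r)e^{im\theta}$ in polar coordinates on the closed unit disk (only the real part if $m=0$), extended by $0$ to $\mathbb R^2$ and multiplied by positive constants so that $\int\psi_k^2=\pi$; put $\mu_k=R_{m,q}^2$. For $j\in\mathbb Z$ let $\psi_{j,k}(u)=2^{-2j}\psi_k(2^{-j}u)$. For a finitely supported real coefficient family $a=(a_k)$ let $\|a\|_{FB}=(\sum_k\mu_ka_k^2)^{1/2}$.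 *DCFNet.* For $l=1,\dots,L$ let $K_l$ be a finite set of indices $k$, $j_l\in\mathbb Z$, $b^{(l)}\colon[M_l]\to\mathbb R$, and for $\lambda'\in[M_{l-1}]$, $\lambda\in[M_l]$ let $a^{(l)}_{\lambda',\lambda}=\big((a^{(l)}_{\lambda',\lambda})_k\big)_{k\in K_l}$ be real coefficients. Let $W^{(l)}_{\lambda',\lambda}=\sum_{k\in K_l}(a^{(l)}_{\lambda',\lambda})_k\,\psi_{j_l,k}$, let $\sigma\colon\mathbb R\to\mathbb R$, and define $x^{(l)}$ from the input $x^{(0)}$ by $$x^{(l)}(u,\lambda)=\sigma\Big(\sum_{\lambda'=1}^{M_{l-1}}\int_{\mathbb R^2}W^{(l)}_{\lambda',\lambda}(v)\,x^{(l-1)}(u+v,\lambda')\,dv+b^{(l)}(\lambda)\Big),\qquad l=1,\dots,L .$$ Write $x^{(L)}[x^{(0)}]$ for the resulting $L$-th layer. *Deformation.* Let $\tau\colon\mathbb R^2\to\mathbb R^2$ be $C^2$, $D_\tau x(u,\lambda)=x(u-\tau(u),\lambda)$, and $|\nabla\tau|_\infty=\sup_u\|\nabla\tau(u)\|$ (operator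 norm). **Theorem.** Assume - (A0) $|\nabla\tau|_\infty<\frac15$; - (A1) $\sigma$ is non-expansive, i.e. $|\sigma(s)-\sigma(t)|\le|s-t|$ for all $s,t\in\mathbb R$; - (A2') for every $l=1,\dots,L$, $$A_l:=\pi\max\Big\{\sup_{\lambda}\sum_{\lambda'=1}^{M_{l-1}}\|a^{(l)}_{\lambda',\lambda}\|_{FB},\ \sup_{\lambda'}\frac{M_{l-1}}{M_l}\sum_{\lambda=1}^{M_l}\|a^{(l)}_{\lambda',\lambda}\|_{FB}\Big\}\le1 .$$ Then for every input $x^{(0)}$ with $x^{(0)}(\cdot,\lambda)\in L^2(\mathbb R^2)$ for all $\lambda\in[M_0]$, every channel of $D_\tau x^{(L)}[x^{(0)}]-x^{(L)}[D_\tau x^{(0)}]$ lies in $L^2(\mathbb R^2)$ and $$\|D_\tau x^{(L)}[x^{(0)}]-x^{(L)}[D_\tau x^{(0)}]\|\le 8L\,|\nabla\tau|_\infty\,\|x^{(0)}\| .$$ -/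

import Mathlib

open MeasureTheory

noncomputable section

/-- The plane `ℝ²` with its Euclidean norm and Lebesgue measure. -/
abbrev Plane : Type := EuclideanSpace ℝ (Fin 2)

/-- A real-valued signal `x(u, c)` on the plane with channels `c ∈ [M]`. -/
abbrev Signal (M : ℕ) : Type := Fin M → Plane → ℝ

/-- The Bessel function of the first kind of order `m = 0, 1, 2, …`, by its power series. -/
def besselJ (m : ℕ) (x : ℝ) : ℝ :=
  ∑' i : ℕ, (-1 : ℝ) ^ i / ((i.factorial : ℝ) * ((i + m).factorial : ℝ)) * (x / 2) ^ (2 * i + m)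

/-- `R` is the `q`-th positive zero of `f` (`q = 1, 2, …`): it is a positive zero, and exactly
`q` zeros of `f` lie in `(0, R]`. -/
def IsNthPosZero (f : ℝ → ℝ) (q : ℕ) (R : ℝ) : Prop :=
  0 < R ∧ f R = 0 ∧ {y : ℝ | 0 < y ∧ y ≤ R ∧ f y = 0}.encard = q

/-- Indices of the real Fourier-Bessel basis: an angular frequency `|m|` (the sign of `m` tells
the cosine function from the sine function), a radial frequency `q`, and the number
`R = R_{|m|,q}`, the `q`-th positive zero of `J_{|m|}`, which is determined by `(m, q)`. -/
structure FBIndex where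
  m : ℤ
  q : ℕ
  R : ℝ
  isZero : IsNthPosZero (besselJ m.natAbs) q R

/-- The polar angle of a point of the plane, in `(-π, π]`. -/
def polarAngle (u : Plane) : ℝ := Complex.arg (⟨u 0, u 1⟩ : ℂ)

namespace FBIndex

/-- The Dirichlet eigenvalue `μ_k = R_{m,q}²`. -/
def eigenvalue (k : FBIndex) : ℝ := k.R ^ 2

open Classical in
/-- The real part (`m ≥ 0`) or the imaginary part (`m < 0`, with frequency `|m|`) of
`J_{|m|}(R r) e^{i |m| θ}` on the closed unit disk, extended by zero to the plane. -/
def rawBasis (k : FBIndex) (u : Plane) : ℝ :=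
  if ‖u‖ ≤ 1 then
    besselJ k.m.natAbs (k.R * ‖u‖) *
      (if 0 ≤ k.m then Real.cos ((k.m.natAbs : ℝ) * polarAngle u)
        else Real.sin ((k.m.natAbs : ℝ) * polarAngle u))
  else 0

/-- The Fourier-Bessel basis function `ψ_k`, normalized so that `∫ ψ_k² = π`. -/
def basis (k : FBIndex) (u : Plane) : ℝ :=
  Real.sqrt (Real.pi / ∫ w : Plane, k.rawBasis w ^ 2) * k.rawBasis u

/-- The rescaled basis function `ψ_{j,k}(u) = 2^{-2j} ψ_k(2^{-j} u)`, supported on the disk of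
radius `2^j`. -/
def scaledBasis (j : ℤ) (k : FBIndex) (u : Plane) : ℝ :=
  (2 : ℝ) ^ (-2 * j) * k.basis ((2 : ℝ) ^ (-j) • u)

end FBIndex

/-- The weighted norm `‖a‖_FB = (∑_{k ∈ K} μ_k a_k²)^{1/2}` of a finite family of expansion
coefficients. -/
def fbNorm (K : Finset FBIndex) (a : FBIndex → ℝ) : ℝ :=
  Real.sqrt (∑ k ∈ K, k.eigenvalue * a k ^ 2)

/-- The deformation operator `D_τ x(u, c) = x(u - τ(u), c)`. -/
def deform (τ : Plane → Plane) {M : ℕ} (x : Signal M) : Signal M :=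
  fun c u => x c (u - τ u)

/-- `|∇τ|_∞`, the supremum over `u` of the operator norm of the derivative of `τ` at `u`
(meaningful when these norms are bounded). -/
def gradSup (τ : Plane → Plane) : ℝ := ⨆ u : Plane, ‖fderiv ℝ τ u‖

/-- The normalized norm of a signal whose channels are square integrable:
`‖x‖² = (1/M) ∑_c (1/|Ω|) ∫ |x(u, c)|² du`, where `|Ω| = (2 · 2^J)²`. -/
def signalNorm (J : ℤ) {M : ℕ} (x : Signal M) : ℝ :=
  Real.sqrt (1 / (M : ℝ) * ∑ c : Fin M,
    1 / (2 * (2 : ℝ) ^ J) ^ 2 * ∫ u : Plane, |x c u| ^ 2)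

/-- One convolutional layer:
`y(u, c) = σ (∑_{c'} ∫ W_{c',c}(v) x(u + v, c') dv + b(c))`. -/
def convLayer (σ : ℝ → ℝ) {M' M : ℕ} (W : Fin M' → Fin M → Plane → ℝ) (b : Fin M → ℝ)
    (x : Signal M') : Signal M :=
  fun c u => σ ((∑ c' : Fin M', ∫ v : Plane, W c' c v * x c' (u + v)) + b c)

/-- A DCFNet with Fourier-Bessel bases. The data carry an index `l : ℕ`, those with index `l`
describing the layer that maps `x^{(l)}` to `x^{(l+1)}`; an `L`-layer network uses only the
layers with `l < L`. -/
structure DCFNet where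
  /-- the number of channels of `x^{(l)}` -/
  M : ℕ → ℕ
  M_pos : ∀ l, 0 < M l
  /-- the nonlinearity -/
  σ : ℝ → ℝ
  /-- the scale of the filters of the layer -/
  j : ℕ → ℤ
  /-- the finitely many basis functions used in the layer -/
  K : ℕ → Finset FBIndex
  /-- the expansion coefficients of the filters -/
  a : (l : ℕ) → Fin (M l) → Fin (M (l + 1)) → FBIndex → ℝ
  /-- the biases -/
  b : (l : ℕ) → Fin (M (l + 1)) → ℝ

namespace DCFNet

/-- The filters `W_{c',c}(u) = ∑_{k ∈ K} (a_{c',c})_k ψ_{j,k}(u)` of a layer. -/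
def filter (N : DCFNet) (l : ℕ) (c' : Fin (N.M l)) (c : Fin (N.M (l + 1))) (u : Plane) : ℝ :=
  ∑ k ∈ N.K l, N.a l c' c k * FBIndex.scaledBasis (N.j l) k u

/-- The output `x^{(l)}[x]` of the first `l` layers, for the input `x`. -/
def output (N : DCFNet) : (l : ℕ) → Signal (N.M 0) → Signal (N.M l)
  | 0, x => x
  | l + 1, x => convLayer N.σ (N.filter l) (N.b l) (N.output l x)

/-- The constant
`A = π max { sup_c ∑_{c'} ‖a_{c',c}‖_FB, sup_{c'} (M'/M) ∑_c ‖a_{c',c}‖_FB }`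
of the layer mapping `M' = M l` channels to `M = M (l + 1)` channels. -/
def coeffBound (N : DCFNet) (l : ℕ) : ℝ :=
  Real.pi * max
    (⨆ c : Fin (N.M (l + 1)), ∑ c' : Fin (N.M l), fbNorm (N.K l) (N.a l c' c))
    (⨆ c' : Fin (N.M l), (N.M l : ℝ) / (N.M (l + 1) : ℝ) *
      ∑ c : Fin (N.M (l + 1)), fbNorm (N.K l) (N.a l c' c))

end DCFNet

end

/-!
# Deformation stability of networks with Fourier-Bessel filters

Write `ρ(u) = u - τ(u)` and `t = |∇τ|_∞`. The estimate is proved layer by layer and reduces to two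
bounds for the correlation with one filter `W`, in terms of its weighted variation
`C(W) = ∫ ‖z‖ ‖∇W(z)‖ dz`: the correlation has `L²` operator norm at most `C(W)`
(`IsConvFilter.eLpNorm_correlate_le`), and its commutator with the deformation has norm at most
`8 t C(W)` (`IsConvFilter.eLpNorm_correlate_deform_sub_le`). After the change of variables `ρ` the
commutator is an integral operator acting on `x ∘ ρ`, with kernel
`|det Dρ(v)| W(ρ v - ρ u) - W(v - u)`. Schur's test applies: the Jacobian differs from `1` by at
most `2t + 2t²`, and the increment `W(ρ v - ρ u) - W(v - u)` is integrated along the segment between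
the two arguments, at whose points `z` one has `‖v - u‖ ≤ ‖z‖ / (1 - t)`. The `L¹` norm of `W` is
itself at most `C(W)`, as the comparison of `W` with a dilation of itself shows.

The basis functions `ψ_k` are restrictions to the disk of smooth functions on the plane which are
Laplace eigenfunctions with eigenvalue `-μ_k` and vanish on the unit circle. Green's identity,
together with the orthogonality of distinct angular factors, makes them orthogonal both in `L²` and
for the Dirichlet form, so that `∑ a_k ψ_k` has Dirichlet energy at most `π ‖a‖_FB²`
(`energy_fbSum_le`), and by the Cauchy-Schwarz inequality `C(W) ≤ π ‖a‖_FB`. Since `ψ_k` is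
Lipschitz as a function on the plane, Green's identity follows from integration by parts for
Lipschitz functions of compact support, without boundary terms.

The bounds between the channels are combined by Schur's test for matrices, where the row and column
sums are those in the definition of `DCFNet.coeffBound`. Hence every layer is non-expansive and its
commutator with the deformation is bounded by `8 t`. Because of the biases the hidden layers need
not be square integrable, but each differs by a square-integrable signal from the response to
the zero input, which is constant in space and so commutes with the deformation. Telescoping
over the layers gives the factor `8 L t`.
-/

open MeasureTheory Set Filter Topology
open scoped ENNReal NNReal

/-! ### Deformations of the plane -/

lemma norm_sub_le_of_norm_fderiv_le {τ : Plane → Plane} (hτ : Differentiable ℝ τ) {t : ℝ}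
    (ht : ∀ u, ‖fderiv ℝ τ u‖ ≤ t) (u v : Plane) : ‖τ u - τ v‖ ≤ t * ‖u - v‖ :=
  convex_univ.norm_image_sub_le_of_norm_fderiv_le (𝕜 := ℝ) (fun x _ => hτ x) (fun x _ => ht x)
    (mem_univ v) (mem_univ u)

lemma norm_sub_le_of_deform {τ : Plane → Plane} (hτ : Differentiable ℝ τ) {t : ℝ}
    (ht : ∀ u, ‖fderiv ℝ τ u‖ ≤ t) (u v : Plane) :
    (1 - t) * ‖u - v‖ ≤ ‖(u - τ u) - (v - τ v)‖ := by
  have h1 := norm_sub_le_of_norm_fderiv_le hτ ht u v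
  have h2 : ‖u - v‖ ≤ ‖(u - τ u) - (v - τ v)‖ + ‖τ u - τ v‖ := by
    have : u - v = ((u - τ u) - (v - τ v)) + (τ u - τ v) := by abel
    conv_lhs => rw [this]
    exact norm_add_le _ _
  linarith

lemma deform_injective {τ : Plane → Plane} (hτ : Differentiable ℝ τ) {t : ℝ}
    (ht : ∀ u, ‖fderiv ℝ τ u‖ ≤ t) (ht1 : t < 1) :
    Function.Injective fun u => u - τ u := by
  intro u v huv
  have h := norm_sub_le_of_deform hτ ht u v
  have h0 : (u - τ u) - (v - τ v) = 0 := sub_eq_zero.2 huv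
  rw [h0, norm_zero] at h
  have : ‖u - v‖ ≤ 0 := by
    by_contra hc
    push Not at hc
    nlinarith
  exact sub_eq_zero.1 (norm_le_zero_iff.1 this)

lemma deform_surjective {τ : Plane → Plane} (hτ : Differentiable ℝ τ) {t : ℝ}
    (ht : ∀ u, ‖fderiv ℝ τ u‖ ≤ t) (ht1 : t < 1) :
    Function.Surjective fun u => u - τ u := by
  intro y
  have ht0 : 0 ≤ t := (norm_nonneg _).trans (ht 0)
  -- a preimage of `y` is a fixed point of the contraction `v ↦ y + τ v`
  have hc : ContractingWith t.toNNReal (fun v => y + τ v) := by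
    refine ⟨by rw [← NNReal.coe_lt_coe, Real.coe_toNNReal _ ht0]; exact_mod_cast ht1, ?_⟩
    refine LipschitzWith.of_dist_le_mul fun a b => ?_
    rw [dist_eq_norm, dist_eq_norm, Real.coe_toNNReal _ ht0, add_sub_add_left_eq_sub]
    exact norm_sub_le_of_norm_fderiv_le hτ ht a b
  refine ⟨hc.fixedPoint, ?_⟩
  have h : y + τ hc.fixedPoint = hc.fixedPoint := hc.fixedPoint_isFixedPt
  exact sub_eq_iff_eq_add.2 h.symm

lemma abs_det_id_sub_sub_one_le (A : Plane →L[ℝ] Plane) {t : ℝ} (hA : ‖A‖ ≤ t) :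
    |(ContinuousLinearMap.id ℝ Plane - A).det - 1| ≤ 2 * t + 2 * t ^ 2 := by
  have ht0 : 0 ≤ t := (norm_nonneg _).trans hA
  have hb : ∀ i j, |(A (EuclideanSpace.single j 1)) i| ≤ t := fun i j => by
    calc |(A (EuclideanSpace.single j 1)) i| ≤ ‖A (EuclideanSpace.single j 1)‖ :=
          PiLp.norm_apply_le (A (EuclideanSpace.single j 1)) i
      _ ≤ ‖A‖ * ‖(EuclideanSpace.single j 1 : Plane)‖ := A.le_opNorm _
      _ ≤ t := by simpa using hA
  have hdet : (ContinuousLinearMap.id ℝ Plane - A).det =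
      (1 - (A (EuclideanSpace.single 0 1)) 0) * (1 - (A (EuclideanSpace.single 1 1)) 1) -
      (A (EuclideanSpace.single 1 1)) 0 * (A (EuclideanSpace.single 0 1)) 1 := by
    rw [ContinuousLinearMap.det,
      ← LinearMap.det_toMatrix (EuclideanSpace.basisFun (Fin 2) ℝ).toBasis, Matrix.det_fin_two]
    simp [LinearMap.toMatrix_apply]
  rw [hdet]
  have h00 := abs_le.1 (hb 0 0)
  have h11 := abs_le.1 (hb 1 1)
  have e1 : |(A (EuclideanSpace.single 0 1)) 0 * (A (EuclideanSpace.single 1 1)) 1| ≤ t * t := by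
    rw [abs_mul]; exact mul_le_mul (hb _ _) (hb _ _) (abs_nonneg _) ht0
  have e2 : |(A (EuclideanSpace.single 1 1)) 0 * (A (EuclideanSpace.single 0 1)) 1| ≤ t * t := by
    rw [abs_mul]; exact mul_le_mul (hb _ _) (hb _ _) (abs_nonneg _) ht0
  rw [abs_le] at e1 e2 ⊢
  constructor <;> nlinarith

/-- The Jacobian `|det (1 - ∇τ)|` of the deformation `u ↦ u - τ u`. -/
noncomputable def deformJacobian (τ : Plane → Plane) (u : Plane) : ℝ :=
  |(ContinuousLinearMap.id ℝ Plane - fderiv ℝ τ u).det|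

lemma measurable_deformJacobian (τ : Plane → Plane) : Measurable (deformJacobian τ) := by
  unfold deformJacobian
  have h : Continuous fun A : Plane →L[ℝ] Plane => |(ContinuousLinearMap.id ℝ Plane - A).det| :=
    (ContinuousLinearMap.continuous_det.comp (continuous_const.sub continuous_id)).abs
  exact h.measurable.comp (measurable_fderiv ℝ τ)

lemma abs_deformJacobian_sub_one_le {τ : Plane → Plane} {t : ℝ}
    (ht : ∀ u, ‖fderiv ℝ τ u‖ ≤ t) (u : Plane) :
    |deformJacobian τ u - 1| ≤ 2 * t + 2 * t ^ 2 := by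
  refine le_trans ?_ (abs_det_id_sub_sub_one_le (fderiv ℝ τ u) (ht u))
  unfold deformJacobian
  simpa using abs_abs_sub_abs_le (ContinuousLinearMap.id ℝ Plane - fderiv ℝ τ u).det 1

lemma le_deformJacobian {τ : Plane → Plane} {t : ℝ}
    (ht : ∀ u, ‖fderiv ℝ τ u‖ ≤ t) (u : Plane) :
    1 - 2 * t - 2 * t ^ 2 ≤ deformJacobian τ u := by
  have := (abs_le.1 (abs_deformJacobian_sub_one_le ht u)).1
  linarith

lemma hasFDerivWithinAt_deform {τ : Plane → Plane} (hτ : Differentiable ℝ τ) (u : Plane) :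
    HasFDerivWithinAt (fun u => u - τ u) (ContinuousLinearMap.id ℝ Plane - fderiv ℝ τ u) univ u :=
  ((hasFDerivAt_id u).sub (hτ u).hasFDerivAt).hasFDerivWithinAt

lemma lintegral_jacobian_mul_deform {τ : Plane → Plane} (hτ : Differentiable ℝ τ) {t : ℝ}
    (ht : ∀ u, ‖fderiv ℝ τ u‖ ≤ t) (ht1 : t < 1) (h : Plane → ℝ≥0∞) :
    ∫⁻ v, ENNReal.ofReal (deformJacobian τ v) * h (v - τ v) = ∫⁻ v, h v := by
  have := lintegral_image_eq_lintegral_abs_det_fderiv_mul volume MeasurableSet.univ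
    (fun u _ => hasFDerivWithinAt_deform hτ u) (deform_injective hτ ht ht1).injOn h
  rw [image_univ, (deform_surjective hτ ht ht1).range_eq] at this
  simpa [deformJacobian] using this.symm

lemma integral_jacobian_mul_deform {τ : Plane → Plane} (hτ : Differentiable ℝ τ) {t : ℝ}
    (ht : ∀ u, ‖fderiv ℝ τ u‖ ≤ t) (ht1 : t < 1) (h : Plane → ℝ) :
    ∫ v, deformJacobian τ v * h (v - τ v) = ∫ v, h v := by
  have := integral_image_eq_integral_abs_det_fderiv_smul volume MeasurableSet.univ
    (fun u _ => hasFDerivWithinAt_deform hτ u) (deform_injective hτ ht ht1).injOn h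
  rw [image_univ, (deform_surjective hτ ht ht1).range_eq] at this
  simpa [deformJacobian] using this.symm

lemma lintegral_comp_deform_le {τ : Plane → Plane} (hτ : Differentiable ℝ τ) {t : ℝ}
    (ht : ∀ u, ‖fderiv ℝ τ u‖ ≤ t) (ht1 : t ≤ 1 / 5) (h : Plane → ℝ≥0∞) :
    ∫⁻ v, h (v - τ v) ≤ ENNReal.ofReal (1 / (1 - 2 * t - 2 * t ^ 2)) * ∫⁻ v, h v := by
  have ht0 : 0 ≤ t := (norm_nonneg _).trans (ht 0)
  have hδ : 0 < 1 - 2 * t - 2 * t ^ 2 := by nlinarith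
  rw [← lintegral_jacobian_mul_deform hτ ht (by linarith) h,
    ← lintegral_const_mul' _ _ ENNReal.ofReal_ne_top]
  refine lintegral_mono fun v => ?_
  rw [← mul_assoc, ← ENNReal.ofReal_mul (by positivity)]
  refine le_mul_of_one_le_left zero_le ?_
  rw [← ENNReal.ofReal_one]
  refine ENNReal.ofReal_le_ofReal ?_
  rw [one_div, ← div_eq_inv_mul, le_div_iff₀ hδ, one_mul]
  exact le_deformJacobian ht v

lemma quasiMeasurePreserving_deform {τ : Plane → Plane} (hτ : Differentiable ℝ τ) {t : ℝ}
    (ht : ∀ u, ‖fderiv ℝ τ u‖ ≤ t) (ht1 : t ≤ 1 / 5) :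
    Measure.QuasiMeasurePreserving (fun u : Plane => u - τ u) volume volume := by
  have hm : Measurable (fun u : Plane => u - τ u) :=
    (continuous_id.sub hτ.continuous).measurable
  refine ⟨hm, Measure.AbsolutelyContinuous.mk fun s hs h0 => ?_⟩
  rw [Measure.map_apply hm hs, ← lintegral_indicator_one (hm hs)]
  have h := lintegral_comp_deform_le hτ ht ht1 (s.indicator 1)
  rw [lintegral_indicator_one hs, h0, mul_zero] at h
  exact le_antisymm h zero_le

lemma lintegral_comp_smul_plane {c : ℝ} (hc : 0 < c) (f : Plane → ℝ≥0∞) :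
    ∫⁻ z, f (c • z) = ENNReal.ofReal (c ^ 2)⁻¹ * ∫⁻ z, f z := by
  have h := (Homeomorph.smulOfNeZero c hc.ne' (α := Plane)).measurableEmbedding.lintegral_map
    (μ := volume) f
  have h2 : Measure.map (Homeomorph.smulOfNeZero c hc.ne' (α := Plane)) volume
      = ENNReal.ofReal (c ^ 2)⁻¹ • (volume : Measure Plane) := by
    have := Measure.map_addHaar_smul (volume : Measure Plane) hc.ne'
    simp only [finrank_euclideanSpace, Fintype.card_fin] at this
    rw [abs_of_pos (by positivity)] at this
    exact this
  rw [h2, lintegral_smul_measure] at h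
  simpa using h.symm

/-! ### Filters and their weighted variation -/

/-- The regularity of a filter used in the single-channel estimates: Lipschitz with compact support,
and differentiable off one circle centred at the origin. -/
structure IsConvFilter (W : Plane → ℝ) : Prop where
  lipschitz : ∃ K, LipschitzWith K W
  hasCompactSupport : HasCompactSupport W
  differentiableAt : ∃ r, ∀ z, ‖z‖ ≠ r → DifferentiableAt ℝ W z

/-- The density `‖z‖ ‖∇W(z)‖`. At points where `W` is not differentiable it is `0`. -/
noncomputable def variationDensity (W : Plane → ℝ) (z : Plane) : ℝ≥0∞ := ‖z‖ₑ * ‖fderiv ℝ W z‖ₑ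

/-- The weighted total variation `∫ ‖z‖ ‖∇W(z)‖ dz` of a filter. It is invariant under the
rescalings `W ↦ c² W(c ·)`. -/
noncomputable def weightedVariation (W : Plane → ℝ) : ℝ≥0∞ := ∫⁻ z, variationDensity W z

lemma measurable_variationDensity (W : Plane → ℝ) : Measurable (variationDensity W) :=
  measurable_enorm.mul (measurable_fderiv ℝ W).enorm

lemma IsConvFilter.continuous {W : Plane → ℝ} (hW : IsConvFilter W) : Continuous W :=
  hW.lipschitz.choose_spec.continuous

lemma finite_setOf_norm_add_smul_eq (p d : Plane) (hd : d ≠ 0) (r : ℝ) :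
    {s : ℝ | ‖p + s • d‖ = r}.Finite := by
  let P : Polynomial ℝ := Polynomial.C (‖d‖ ^ 2) * Polynomial.X ^ 2 +
    Polynomial.C (2 * inner ℝ p d) * Polynomial.X + Polynomial.C (‖p‖ ^ 2 - r ^ 2)
  have hP : P ≠ 0 := by
    intro h
    have h2 : P.coeff 2 = 0 := by rw [h, Polynomial.coeff_zero]
    have : ‖d‖ ^ 2 = 0 := by
      simpa only [P, Polynomial.coeff_add, Polynomial.coeff_C_mul, Polynomial.coeff_X_pow,
        Polynomial.coeff_X, Polynomial.coeff_C, if_true, OfNat.ofNat_ne_one, OfNat.one_ne_ofNat,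
        OfNat.ofNat_ne_zero, if_false, mul_zero, mul_one, add_zero] using h2
    exact hd (norm_eq_zero.1 (pow_eq_zero_iff two_ne_zero |>.1 this))
  refine (P.rootSet_finite ℝ).subset fun s hs => ?_
  rw [Polynomial.mem_rootSet]
  refine ⟨hP, ?_⟩
  have h1 : ‖p + s • d‖ ^ 2 = r ^ 2 := by rw [show ‖p + s • d‖ = r from hs]
  rw [norm_add_sq_real, inner_smul_right, norm_smul, mul_pow, Real.norm_eq_abs, sq_abs] at h1
  simp only [P, map_add, map_mul, Polynomial.aeval_C, Polynomial.aeval_X, map_pow]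
  simp only [Algebra.algebraMap_self, RingHom.id_apply, map_sub, map_pow]
  linarith

/-- The fundamental theorem of calculus along a segment: off a null set of parameters the segment
avoids the circle on which the filter may fail to be differentiable. -/
lemma IsConvFilter.enorm_sub_le_lintegral {W : Plane → ℝ} (hW : IsConvFilter W) (p d : Plane) :
    ‖W (p + d) - W p‖ₑ ≤ ∫⁻ s in Ioc (0 : ℝ) 1, ‖fderiv ℝ W (p + s • d)‖ₑ * ‖d‖ₑ := by
  rcases eq_or_ne d 0 with rfl | hd
  · simp
  obtain ⟨K, hK⟩ := hW.lipschitz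
  obtain ⟨r, hr⟩ := hW.differentiableAt
  have hline : LipschitzWith ‖d‖₊ fun s : ℝ => p + s • d :=
    LipschitzWith.of_dist_le_mul fun a b => by
      rw [dist_add_left, dist_eq_norm, ← sub_smul, norm_smul, dist_eq_norm, mul_comm, coe_nnnorm]
  have hφ := (hK.comp hline).lipschitzOnWith (s := uIcc (0 : ℝ) 1)
  have h := hφ.absolutelyContinuousOnInterval.integral_deriv_eq_sub
  simp only [Function.comp_apply, one_smul, zero_smul, add_zero] at h
  rw [← h, intervalIntegral.integral_of_le zero_le_one]
  refine (enorm_integral_le_lintegral_enorm _).trans (lintegral_mono_ae ?_)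
  have hfin : ∀ᵐ s : ℝ ∂volume.restrict (Ioc 0 1), ‖p + s • d‖ ≠ r :=
    ae_restrict_of_ae (((finite_setOf_norm_add_smul_eq p d hd r).countable).ae_notMem volume)
  filter_upwards [hfin] with s hs
  have hd1 : HasDerivAt (fun s : ℝ => p + s • d) d s := by
    simpa using ((hasDerivAt_id s).smul_const d).const_add p
  have hd2 := (hr _ hs).hasFDerivAt.comp_hasDerivAt s hd1
  rw [hd2.deriv, ← enorm_norm, ← enorm_norm (fderiv ℝ W (p + s • d)), ← enorm_norm d, ← enorm_mul]
  refine enorm_le_iff_norm_le.2 ?_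
  rw [norm_norm, norm_mul, norm_norm, norm_norm]
  exact ContinuousLinearMap.le_opNorm _ _

/-- The interpolation between the filter kernel and its deformed version, through the deformations
`u ↦ u - s τ(u)` for `0 ≤ s ≤ 1`. -/
lemma IsConvFilter.enorm_deform_sub_le {W : Plane → ℝ} (hW : IsConvFilter W) {τ : Plane → Plane}
    (hτ : Differentiable ℝ τ) {t : ℝ} (ht : ∀ u, ‖fderiv ℝ τ u‖ ≤ t) (ht1 : t < 1)
    (u v : Plane) :
    ‖W ((v - τ v) - (u - τ u)) - W (v - u)‖ₑ ≤ ENNReal.ofReal (t / (1 - t)) *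
      ∫⁻ s in Ioc (0 : ℝ) 1, variationDensity W ((v - s • τ v) - (u - s • τ u)) := by
  have ht0 : 0 ≤ t := (norm_nonneg _).trans (ht 0)
  have h := hW.enorm_sub_le_lintegral (v - u) (-(τ v - τ u))
  rw [show v - u + -(τ v - τ u) = (v - τ v) - (u - τ u) by abel] at h
  refine h.trans ?_
  rw [← lintegral_const_mul' _ _ ENNReal.ofReal_ne_top]
  refine setLIntegral_mono' measurableSet_Ioc fun s hs => ?_
  have e : v - u + s • -(τ v - τ u) = (v - s • τ v) - (u - s • τ u) := by
    rw [smul_neg, smul_sub]; abel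
  rw [e, variationDensity, mul_comm, ← mul_assoc]
  refine mul_le_mul_left ?_ _
  rw [← ofReal_norm, ← ofReal_norm, ← ENNReal.ofReal_mul (by
    have : 0 < 1 - t := by linarith
    positivity)]
  refine ENNReal.ofReal_le_ofReal ?_
  have h1 := norm_sub_le_of_norm_fderiv_le hτ ht v u
  rw [norm_neg, div_mul_eq_mul_div, le_div_iff₀ (by linarith)]
  have h2 : ‖v - u‖ ≤ ‖(v - s • τ v) - (u - s • τ u)‖ + s * ‖τ v - τ u‖ := by
    have e3 : v - u = ((v - s • τ v) - (u - s • τ u)) + s • (τ v - τ u) := by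
      rw [smul_sub]; abel
    conv_lhs => rw [e3]
    refine (norm_add_le _ _).trans ?_
    rw [norm_smul, Real.norm_of_nonneg hs.1.le]
  have h3 : s * ‖τ v - τ u‖ ≤ t * ‖v - u‖ := by
    refine le_trans ?_ h1
    exact mul_le_of_le_one_left (norm_nonneg _) hs.2
  have h4 : (1 - t) * ‖v - u‖ ≤ ‖(v - s • τ v) - (u - s • τ u)‖ := by linarith
  calc ‖τ v - τ u‖ * (1 - t) ≤ t * ‖v - u‖ * (1 - t) :=
        mul_le_mul_of_nonneg_right h1 (by linarith)
    _ = t * ((1 - t) * ‖v - u‖) := by ring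
    _ ≤ _ := mul_le_mul_of_nonneg_left h4 ht0

lemma norm_fderiv_smul_le {τ : Plane → Plane} {t : ℝ}
    (hτ : Differentiable ℝ τ) (ht : ∀ u, ‖fderiv ℝ τ u‖ ≤ t) {s : ℝ} (hs : s ∈ Ioc (0 : ℝ) 1)
    (u : Plane) : ‖fderiv ℝ (fun u => s • τ u) u‖ ≤ t := by
  rw [fderiv_fun_const_smul (hτ u), norm_smul, Real.norm_of_nonneg hs.1.le]
  exact (mul_le_of_le_one_left (norm_nonneg _) hs.2).trans (ht u)

/-- The constant `t / ((1 - t)(1 - 2t - 2t²))`: `t / (1 - t)` bounds `‖τ(v) - τ(u)‖` by the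
norm of the deformed version of `v - u`, and `1 - 2t - 2t²` is a lower bound for the Jacobian. -/
noncomputable def deformConst (t : ℝ) : ℝ := t / (1 - t) * (1 / (1 - 2 * t - 2 * t ^ 2))

lemma ofReal_mul_lintegral_deform_le {τ : Plane → Plane} (hτ : Differentiable ℝ τ) {t : ℝ}
    (ht : ∀ u, ‖fderiv ℝ τ u‖ ≤ t) (ht1 : t ≤ 1 / 5) {C : ℝ≥0∞}
    (f : Plane → ℝ → Plane → ℝ≥0∞) (hC : ∀ w s, ∫⁻ z, f w s z = C)
    (hm : ∀ u, Measurable fun q : Plane × ℝ => f u q.2 (q.1 - q.2 • τ q.1)) (u : Plane) :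
    ∫⁻ v, ENNReal.ofReal (t / (1 - t)) * ∫⁻ s in Ioc (0 : ℝ) 1, f u s (v - s • τ v) ≤
      ENNReal.ofReal (deformConst t) * C := by
  have ht0 : 0 ≤ t := (norm_nonneg _).trans (ht 0)
  rw [lintegral_const_mul' _ _ ENNReal.ofReal_ne_top, deformConst,
    ENNReal.ofReal_mul (div_nonneg ht0 (by linarith)), mul_assoc]
  refine mul_le_mul_right ?_ _
  rw [lintegral_lintegral_swap (hm u).aemeasurable]
  calc _ ≤ ∫⁻ s in Ioc (0 : ℝ) 1, ENNReal.ofReal (1 / (1 - 2 * t - 2 * t ^ 2)) * C := by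
        refine setLIntegral_mono' measurableSet_Ioc fun s hs => ?_
        have := lintegral_comp_deform_le (hτ.const_smul s)
          (norm_fderiv_smul_le hτ ht hs) ht1 (f u s)
        rwa [hC] at this
    _ = _ := by simp

lemma IsConvFilter.lintegral_deform_sub_right_le {W : Plane → ℝ} (hW : IsConvFilter W)
    {τ : Plane → Plane} (hτ : Differentiable ℝ τ) {t : ℝ} (ht : ∀ u, ‖fderiv ℝ τ u‖ ≤ t)
    (ht1 : t ≤ 1 / 5) (u : Plane) :
    ∫⁻ v, ‖W ((v - τ v) - (u - τ u)) - W (v - u)‖ₑ ≤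
      ENNReal.ofReal (deformConst t) * weightedVariation W := by
  refine (lintegral_mono fun v => hW.enorm_deform_sub_le hτ ht (by linarith) u v).trans ?_
  refine ofReal_mul_lintegral_deform_le hτ ht ht1
    (fun u s z => variationDensity W (z - (u - s • τ u)))
    (fun w s => lintegral_sub_right_eq_self (variationDensity W) _) (fun u => ?_) u
  have := hτ.continuous
  exact (measurable_variationDensity W).comp
    (by fun_prop : Continuous fun q : Plane × ℝ =>
      (q.1 - q.2 • τ q.1) - (u - q.2 • τ u)).measurable

lemma IsConvFilter.lintegral_deform_sub_left_le {W : Plane → ℝ} (hW : IsConvFilter W)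
    {τ : Plane → Plane} (hτ : Differentiable ℝ τ) {t : ℝ} (ht : ∀ u, ‖fderiv ℝ τ u‖ ≤ t)
    (ht1 : t ≤ 1 / 5) (v : Plane) :
    ∫⁻ u, ‖W ((v - τ v) - (u - τ u)) - W (v - u)‖ₑ ≤
      ENNReal.ofReal (deformConst t) * weightedVariation W := by
  refine (lintegral_mono fun u => hW.enorm_deform_sub_le hτ ht (by linarith) u v).trans ?_
  refine ofReal_mul_lintegral_deform_le hτ ht ht1
    (fun v s z => variationDensity W ((v - s • τ v) - z))
    (fun w s => lintegral_sub_left_eq_self (variationDensity W) _) (fun u => ?_) v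
  have := hτ.continuous
  exact (measurable_variationDensity W).comp
    (by fun_prop : Continuous fun q : Plane × ℝ =>
      (u - q.2 • τ u) - (q.1 - q.2 • τ q.1)).measurable

lemma IsConvFilter.lintegral_enorm_lt_top {W : Plane → ℝ} (hW : IsConvFilter W) :
    ∫⁻ z, ‖W z‖ₑ < ∞ :=
  (hW.continuous.integrable_of_hasCompactSupport hW.hasCompactSupport).2

/-- The `L¹` norm is controlled by the weighted variation, as one sees by comparing `W` with its
dilation by `9/10`, which is the deformation with `τ(u) = u/10`. -/
lemma IsConvFilter.lintegral_enorm_le {W : Plane → ℝ} (hW : IsConvFilter W) :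
    ∫⁻ z, ‖W z‖ₑ ≤ weightedVariation W := by
  have hτ : Differentiable ℝ fun u : Plane => (1 / 10 : ℝ) • u := by fun_prop
  have ht : ∀ u : Plane, ‖fderiv ℝ (fun u : Plane => (1 / 10 : ℝ) • u) u‖ ≤ 1 / 10 := fun u => by
    rw [fderiv_fun_const_smul differentiableAt_fun_id, norm_smul, fderiv_fun_id]
    refine (mul_le_mul_of_nonneg_left ContinuousLinearMap.norm_id_le (norm_nonneg _)).trans ?_
    norm_num
  have h := hW.lintegral_deform_sub_right_le hτ ht (by norm_num) 0
  have e : ∀ v : Plane,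
      v - (1 / 10 : ℝ) • v - (0 - (1 / 10 : ℝ) • (0 : Plane)) = (9 / 10 : ℝ) • v := by
    intro v
    rw [smul_zero, sub_zero, sub_zero]
    nth_rewrite 1 [← one_smul ℝ v]
    rw [← sub_smul]; norm_num
  simp only [e, sub_zero] at h
  have h2 : ∫⁻ z, ‖W ((9 / 10 : ℝ) • z)‖ₑ ≤
      (∫⁻ z, ‖W ((9 / 10 : ℝ) • z) - W z‖ₑ) + ∫⁻ z, ‖W z‖ₑ := by
    rw [← lintegral_add_right _ hW.continuous.measurable.enorm]
    refine lintegral_mono fun z => ?_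
    simpa using enorm_add_le (W ((9 / 10 : ℝ) • z) - W z) (W z)
  rw [lintegral_comp_smul_plane (by norm_num) fun z => ‖W z‖ₑ] at h2
  have h3 := h2.trans (add_le_add_left h _)
  have hB := hW.lintegral_enorm_lt_top
  generalize ∫⁻ z, ‖W z‖ₑ = B at h3 hB
  generalize weightedVariation W = C at h3
  rcases eq_or_ne C ∞ with rfl | hC
  · exact le_top
  lift B to ℝ≥0 using hB.ne
  lift C to ℝ≥0 using hC
  rw [ENNReal.ofReal, ENNReal.ofReal] at h3
  norm_cast at h3 ⊢
  rw [← NNReal.coe_le_coe] at h3 ⊢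
  push_cast at h3
  rw [Real.coe_toNNReal _ (by norm_num),
    Real.coe_toNNReal _ (by unfold deformConst; norm_num)] at h3
  unfold deformConst at h3
  norm_num at h3
  have := C.coe_nonneg
  linarith

/-! ### Square-integrability estimates in a single channel -/

lemma eLpNorm_two_sq {α : Type*} [MeasurableSpace α] {μ : Measure α} (f : α → ℝ) :
    eLpNorm f 2 μ ^ 2 = ∫⁻ u, ‖f u‖ₑ ^ 2 ∂μ := by
  have h := eLpNorm_nnreal_pow_eq_lintegral (μ := μ) (f := f) (p := 2) two_ne_zero
  rw [show ((2 : ℝ≥0) : ℝ≥0∞) = 2 from rfl, show ((2 : ℝ≥0) : ℝ) = ((2 : ℕ) : ℝ) by norm_num] at h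
  simpa only [ENNReal.rpow_natCast] using h

/-- The Cauchy-Schwarz inequality for the measure with density `k`. -/
lemma lintegral_mul_sq_le {α : Type*} [MeasurableSpace α] {μ : Measure α} {k f : α → ℝ≥0∞}
    (hk : Measurable k) (hf : Measurable f) :
    (∫⁻ v, k v * f v ∂μ) ^ 2 ≤ (∫⁻ v, k v ∂μ) * ∫⁻ v, k v * f v ^ 2 ∂μ := by
  have h := ENNReal.lintegral_mul_le_Lp_mul_Lq μ Real.HolderConjugate.two_two
    (hk.pow_const (1 / 2 : ℝ)).aemeasurable ((hk.pow_const (1 / 2 : ℝ)).mul hf).aemeasurable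
  have e1 : ∀ a : ℝ≥0∞, a ^ (1 / 2 : ℝ) * a ^ (1 / 2 : ℝ) = a := fun a => by
    rw [← ENNReal.rpow_add_of_nonneg _ _ (by norm_num) (by norm_num)]; norm_num
  have e2 : ∀ a : ℝ≥0∞, (a ^ (1 / 2 : ℝ)) ^ (2 : ℝ) = a := fun a => by
    rw [← ENNReal.rpow_mul]; norm_num
  simp only [Pi.mul_apply, ← mul_assoc, e1, ENNReal.mul_rpow_of_nonneg _ _ zero_le_two, e2] at h
  calc (∫⁻ v, k v * f v ∂μ) ^ 2 ≤ _ := pow_le_pow_left' h 2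
    _ = _ := by
      rw [mul_pow]
      simp only [← ENNReal.rpow_natCast, ← ENNReal.rpow_mul]
      norm_num

/-- Schur's test with a weight `w` in the column bound. -/
lemma lintegral_sq_le_of_schur {k : Plane → Plane → ℝ≥0∞} (hk : Measurable (Function.uncurry k))
    {f w : Plane → ℝ≥0∞} (hf : AEMeasurable f) {a : ℝ≥0∞} (ha : a ≠ ∞)
    (h1 : ∀ u, ∫⁻ v, k u v ≤ a) (h2 : ∀ v, ∫⁻ u, k u v ≤ a * w v) :
    ∫⁻ u, (∫⁻ v, k u v * f v) ^ 2 ≤ a ^ 2 * ∫⁻ v, w v * f v ^ 2 := by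
  wlog hfm : Measurable f generalizing f
  · have h := this hf.measurable_mk.aemeasurable hf.measurable_mk
    have e1 : ∀ u, ∫⁻ v, k u v * f v = ∫⁻ v, k u v * hf.mk f v := fun u =>
      lintegral_congr_ae (by filter_upwards [hf.ae_eq_mk] with v hv; rw [hv])
    have e2 : ∫⁻ v, w v * f v ^ 2 = ∫⁻ v, w v * hf.mk f v ^ 2 :=
      lintegral_congr_ae (by filter_upwards [hf.ae_eq_mk] with v hv; rw [hv])
    simpa only [e1, e2] using h
  calc ∫⁻ u, (∫⁻ v, k u v * f v) ^ 2
      ≤ ∫⁻ u, a * ∫⁻ v, k u v * f v ^ 2 := lintegral_mono fun u =>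
        (lintegral_mul_sq_le (hk.comp measurable_prodMk_left) hfm).trans
          (mul_le_mul_left (h1 u) _)
    _ = a * ∫⁻ v, ∫⁻ u, k u v * f v ^ 2 := by
        rw [lintegral_const_mul' _ _ ha, lintegral_lintegral_swap]
        exact (hk.mul ((hfm.comp measurable_snd).pow_const 2)).aemeasurable
    _ = a * ∫⁻ v, (∫⁻ u, k u v) * f v ^ 2 := by
        congr 1
        exact lintegral_congr fun v => lintegral_mul_const _ (hk.comp measurable_prodMk_right)
    _ ≤ a * ∫⁻ v, a * (w v * f v ^ 2) := by
        refine mul_le_mul_right (lintegral_mono fun v => ?_) _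
        rw [← mul_assoc]
        exact mul_le_mul_left (h2 v) _
    _ = _ := by rw [lintegral_const_mul' _ _ ha, ← mul_assoc, sq]

/-- The correlation `∫ W(v) x(u + v) dv` of a signal with a filter. -/
noncomputable def correlate (W x : Plane → ℝ) (u : Plane) : ℝ := ∫ v, W v * x (u + v)

lemma correlate_eq (W x : Plane → ℝ) (u : Plane) :
    correlate W x u = ∫ v, W (v - u) * x v := by
  rw [← integral_add_left_eq_self (fun v => W (v - u) * x v) u]
  simp [correlate]

lemma IsConvFilter.integrable_mul {W : Plane → ℝ} (hW : IsConvFilter W) {x : Plane → ℝ}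
    (hx : LocallyIntegrable x) (u : Plane) : Integrable fun v => W (v - u) * x v := by
  have h := hx.integrable_smul_left_of_hasCompactSupport (g := fun v => W (v - u))
    (hW.continuous.comp (continuous_id.sub continuous_const))
    (hW.hasCompactSupport.comp_homeomorph (Homeomorph.subRight u))
  simpa using h

lemma IsConvFilter.integrable_mul_add {W : Plane → ℝ} (hW : IsConvFilter W) {x : Plane → ℝ}
    (hx : LocallyIntegrable x) (u : Plane) : Integrable fun v => W v * x (u + v) := by
  simpa using (hW.integrable_mul hx u).comp_add_left u

lemma aestronglyMeasurable_correlate {W : Plane → ℝ} (hW : IsConvFilter W) {x : Plane → ℝ}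
    (hx : AEStronglyMeasurable x volume) : AEStronglyMeasurable (correlate W x) volume := by
  have e : correlate W x = fun u => ∫ v, W (v - u) * hx.mk x v := by
    funext u
    rw [correlate_eq]
    exact integral_congr_ae (by filter_upwards [hx.ae_eq_mk] with v hv; rw [hv])
  rw [e]
  refine StronglyMeasurable.aestronglyMeasurable ?_
  refine StronglyMeasurable.integral_prod_right (f := fun u v => W (v - u) * hx.mk x v) ?_
  refine StronglyMeasurable.mul ?_ (hx.stronglyMeasurable_mk.comp_measurable measurable_snd)
  exact (hW.continuous.comp (continuous_snd.sub continuous_fst)).stronglyMeasurable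

lemma eLpNorm_two_le_of_sq_le {f g : Plane → ℝ} {a : ℝ≥0∞}
    (h : ∫⁻ u, ‖f u‖ₑ ^ 2 ≤ a ^ 2 * ∫⁻ u, ‖g u‖ₑ ^ 2) :
    eLpNorm f 2 volume ≤ a * eLpNorm g 2 volume := by
  rw [← eLpNorm_two_sq, ← eLpNorm_two_sq, ← mul_pow] at h
  exact (ENNReal.pow_le_pow_left_iff two_ne_zero).1 h

/-- Young's inequality for the correlation with a filter of finite weighted variation. -/
lemma IsConvFilter.eLpNorm_correlate_le {W : Plane → ℝ} (hW : IsConvFilter W) {β : ℝ≥0∞}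
    (hβ : β ≠ ∞) (hWβ : weightedVariation W ≤ β) {x : Plane → ℝ}
    (hx : AEStronglyMeasurable x volume) :
    eLpNorm (correlate W x) 2 volume ≤ β * eLpNorm x 2 volume := by
  refine eLpNorm_two_le_of_sq_le ?_
  have hB := hW.lintegral_enorm_le.trans hWβ
  have h := lintegral_sq_le_of_schur (k := fun u v => ‖W (v - u)‖ₑ) (w := 1)
    (hW.continuous.comp (continuous_snd.sub continuous_fst)).measurable.enorm hx.enorm hβ
    (fun u => by rwa [lintegral_sub_right_eq_self (fun z => ‖W z‖ₑ)])
    (fun v => by simpa [lintegral_sub_left_eq_self (fun z => ‖W z‖ₑ)] using hB)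
  simp only [Pi.one_apply, one_mul] at h
  refine le_trans (lintegral_mono fun u => pow_le_pow_left' ?_ 2) h
  rw [correlate_eq]
  refine (enorm_integral_le_lintegral_enorm _).trans_eq ?_
  simp only [enorm_mul]

lemma MemLp.comp_deform {τ : Plane → Plane} (hτ : Differentiable ℝ τ) {t : ℝ}
    (ht : ∀ u, ‖fderiv ℝ τ u‖ ≤ t) (ht1 : t ≤ 1 / 5) {x : Plane → ℝ} (hx : MemLp x 2 volume) :
    MemLp (fun u => x (u - τ u)) 2 volume := by
  refine ⟨hx.1.comp_quasiMeasurePreserving (quasiMeasurePreserving_deform hτ ht ht1), ?_⟩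
  have h := lintegral_comp_deform_le hτ ht ht1 fun v => ‖x v‖ₑ ^ 2
  rw [← eLpNorm_two_sq, ← eLpNorm_two_sq x] at h
  have h2 : eLpNorm x 2 volume ^ 2 < ∞ := ENNReal.pow_lt_top hx.2
  have h3 := h.trans_lt (ENNReal.mul_lt_top ENNReal.ofReal_lt_top h2)
  by_contra hc
  rw [not_lt_top_iff] at hc
  simp [hc] at h3

lemma IsConvFilter.enorm_correlate_deform_sub_le {W : Plane → ℝ} (hW : IsConvFilter W)
    {τ : Plane → Plane} (hτ : Differentiable ℝ τ) {t : ℝ} (ht : ∀ u, ‖fderiv ℝ τ u‖ ≤ t)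
    (ht1 : t ≤ 1 / 5) {x : Plane → ℝ} (hx : MemLp x 2 volume) (u : Plane) :
    ‖correlate W x (u - τ u) - correlate W (fun u => x (u - τ u)) u‖ₑ ≤
      ∫⁻ v, ‖deformJacobian τ v * W ((v - τ v) - (u - τ u)) - W (v - u)‖ₑ * ‖x (v - τ v)‖ₑ := by
  have hx1 : LocallyIntegrable x := hx.locallyIntegrable (by norm_num)
  have hx2 : LocallyIntegrable fun u => x (u - τ u) :=
    (MemLp.comp_deform hτ ht ht1 hx).locallyIntegrable (by norm_num)
  have i1 := hW.integrable_mul hx1 (u - τ u)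
  have i2 := hW.integrable_mul hx2 u
  have i3 : Integrable fun v =>
      deformJacobian τ v * (W ((v - τ v) - (u - τ u)) * x (v - τ v)) := by
    have := integrableOn_image_iff_integrableOn_abs_det_fderiv_smul volume MeasurableSet.univ
      (fun u _ => hasFDerivWithinAt_deform hτ u)
      (deform_injective hτ ht (by linarith)).injOn fun v => W (v - (u - τ u)) * x v
    rw [image_univ, (deform_surjective hτ ht (by linarith)).range_eq, integrableOn_univ,
      integrableOn_univ] at this
    simpa [deformJacobian] using this.1 i1
  rw [correlate_eq, correlate_eq,
    ← integral_jacobian_mul_deform hτ ht (by linarith) (fun v => W (v - (u - τ u)) * x v),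
    ← integral_sub i3 i2]
  refine (enorm_integral_le_lintegral_enorm _).trans_eq (lintegral_congr fun v => ?_)
  rw [← enorm_mul]
  congr 1
  ring

/-- For `t ≤ 1/5` one has `1 - 2t - 2t² ≥ 13/25`, so that the left side is at most
`(5/4 + 12/5) (25/13) t`, where `(5/4 + 12/5) (25/13) < 8`. -/
lemma deformConst_add_le {t : ℝ} (ht0 : 0 ≤ t) (ht1 : t ≤ 1 / 5) :
    deformConst t + (2 * t + 2 * t ^ 2) * (1 / (1 - 2 * t - 2 * t ^ 2)) ≤ 8 * t := by
  have hδ : 13 / 25 ≤ 1 - 2 * t - 2 * t ^ 2 := by nlinarith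
  have h1 : 1 / (1 - 2 * t - 2 * t ^ 2) ≤ 25 / 13 := by
    rw [div_le_iff₀ (by linarith)]; linarith
  have h2 : t / (1 - t) ≤ t * (5 / 4) := by
    rw [div_le_iff₀ (by linarith)]; nlinarith
  have h3 : 2 * t + 2 * t ^ 2 ≤ 12 / 5 * t := by nlinarith
  have h0 : 0 ≤ 1 / (1 - 2 * t - 2 * t ^ 2) := by
    have : 0 < 1 - 2 * t - 2 * t ^ 2 := by linarith
    positivity
  unfold deformConst
  rw [← add_mul]
  calc _ ≤ (t * (5 / 4) + 12 / 5 * t) * (25 / 13) :=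
        mul_le_mul (add_le_add h2 h3) h1 h0 (by nlinarith)
    _ ≤ 8 * t := by linarith

/-- The commutator of the correlation with a deformation. After the change of variables `v - τ(v)`
it is an integral operator with kernel `|J(v)| W(v - τ(v) - u + τ(u)) - W(v - u)`, `J` the Jacobian
determinant, to which Schur's test applies. -/
lemma IsConvFilter.eLpNorm_correlate_deform_sub_le {W : Plane → ℝ} (hW : IsConvFilter W)
    {β : ℝ≥0∞} (hβ : β ≠ ∞) (hWβ : weightedVariation W ≤ β)
    {τ : Plane → Plane} (hτ : Differentiable ℝ τ) {t : ℝ} (ht : ∀ u, ‖fderiv ℝ τ u‖ ≤ t)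
    (ht1 : t ≤ 1 / 5) {x : Plane → ℝ} (hx : MemLp x 2 volume) :
    eLpNorm (fun u => correlate W x (u - τ u) - correlate W (fun u => x (u - τ u)) u) 2 volume ≤
      ENNReal.ofReal (8 * t) * β * eLpNorm x 2 volume := by
  have ht0 : 0 ≤ t := (norm_nonneg _).trans (ht 0)
  have hδ : 0 < 1 - 2 * t - 2 * t ^ 2 := by nlinarith
  have hB := hW.lintegral_enorm_le.trans hWβ
  have hWm := hW.continuous.measurable
  have hτc := hτ.continuous
  have hJ0 : ∀ v, 0 ≤ deformJacobian τ v := fun v => abs_nonneg _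
  have hJe : ∀ v, ‖deformJacobian τ v‖ₑ = ENNReal.ofReal (deformJacobian τ v) := fun v =>
    Real.enorm_of_nonneg (hJ0 v)
  have hJ1 : ∀ v, ‖deformJacobian τ v - 1‖ₑ ≤ ENNReal.ofReal (2 * t + 2 * t ^ 2) := fun v => by
    rw [← ofReal_norm]
    exact ENNReal.ofReal_le_ofReal (abs_deformJacobian_sub_one_le ht v)
  have hW1 : ∀ u, Measurable fun v => ‖W ((v - τ v) - (u - τ u))‖ₑ := fun u =>
    (hW.continuous.comp (by fun_prop : Continuous fun v => (v - τ v) - (u - τ u))).measurable.enorm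
  have hD0 : 0 ≤ deformConst t := by
    unfold deformConst
    have : 0 < 1 - t := by linarith
    positivity
  have hconst : ENNReal.ofReal (deformConst t) * β + ENNReal.ofReal (2 * t + 2 * t ^ 2) *
      (ENNReal.ofReal (1 / (1 - 2 * t - 2 * t ^ 2)) * β) ≤ ENNReal.ofReal (8 * t) * β := by
    rw [← mul_assoc, ← add_mul, ← ENNReal.ofReal_mul (by positivity),
      ← ENNReal.ofReal_add hD0 (by positivity)]
    exact mul_le_mul_left (ENNReal.ofReal_le_ofReal (deformConst_add_le ht0 ht1)) _
  refine eLpNorm_two_le_of_sq_le ?_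
  have h := lintegral_sq_le_of_schur
    (k := fun u v => ‖deformJacobian τ v * W ((v - τ v) - (u - τ u)) - W (v - u)‖ₑ)
    (f := fun v => ‖x (v - τ v)‖ₑ) (w := fun v => ENNReal.ofReal (deformJacobian τ v))
    (a := ENNReal.ofReal (8 * t) * β) ?_
    (MemLp.comp_deform hτ ht ht1 hx).1.enorm (ENNReal.mul_ne_top ENNReal.ofReal_ne_top hβ) ?_ ?_
  · rw [lintegral_jacobian_mul_deform hτ ht (by linarith) fun v => ‖x v‖ₑ ^ 2] at h
    refine le_trans (lintegral_mono fun u => pow_le_pow_left' ?_ 2) h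
    exact hW.enorm_correlate_deform_sub_le hτ ht ht1 hx u
  · refine Measurable.enorm (Measurable.sub (Measurable.mul ?_ ?_) ?_)
    · exact (measurable_deformJacobian τ).comp measurable_snd
    · exact (hW.continuous.comp (by fun_prop : Continuous fun q : Plane × Plane =>
        (q.2 - τ q.2) - (q.1 - τ q.1))).measurable
    · exact (hW.continuous.comp (continuous_snd.sub continuous_fst)).measurable
  · intro u
    -- `J W' - W = (W' - W) + (J - 1) W'`
    calc ∫⁻ v, ‖deformJacobian τ v * W ((v - τ v) - (u - τ u)) - W (v - u)‖ₑ
        ≤ ∫⁻ v, (‖W ((v - τ v) - (u - τ u)) - W (v - u)‖ₑ +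
            ENNReal.ofReal (2 * t + 2 * t ^ 2) * ‖W ((v - τ v) - (u - τ u))‖ₑ) := by
          refine lintegral_mono fun v => ?_
          have e : deformJacobian τ v * W ((v - τ v) - (u - τ u)) - W (v - u) =
              (W ((v - τ v) - (u - τ u)) - W (v - u)) +
              (deformJacobian τ v - 1) * W ((v - τ v) - (u - τ u)) := by ring
          rw [e]
          refine (enorm_add_le _ _).trans (add_le_add_right ?_ _)
          rw [enorm_mul]
          exact mul_le_mul_left (hJ1 v) _
      _ ≤ _ := by
          rw [lintegral_add_right _ ((hW1 u).const_mul _), lintegral_const_mul' _ _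
            ENNReal.ofReal_ne_top]
          refine le_trans (add_le_add ((hW.lintegral_deform_sub_right_le hτ ht ht1 u).trans
            (mul_le_mul_right hWβ _)) (mul_le_mul_right ?_ _)) hconst
          refine (lintegral_comp_deform_le hτ ht ht1 fun v => ‖W (v - (u - τ u))‖ₑ).trans
            (mul_le_mul_right ?_ _)
          rwa [lintegral_sub_right_eq_self (fun z => ‖W z‖ₑ)]
  · intro v
    -- `J W' - W = J (W' - W) + (J - 1) W`, and `1` is at most a multiple of `J`
    calc ∫⁻ u, ‖deformJacobian τ v * W ((v - τ v) - (u - τ u)) - W (v - u)‖ₑ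
        ≤ ∫⁻ u, (ENNReal.ofReal (deformJacobian τ v) *
              ‖W ((v - τ v) - (u - τ u)) - W (v - u)‖ₑ +
            ENNReal.ofReal (2 * t + 2 * t ^ 2) * ‖W (v - u)‖ₑ) := by
          refine lintegral_mono fun u => ?_
          have e : deformJacobian τ v * W ((v - τ v) - (u - τ u)) - W (v - u) =
              deformJacobian τ v * (W ((v - τ v) - (u - τ u)) - W (v - u)) +
              (deformJacobian τ v - 1) * W (v - u) := by ring
          rw [e]
          refine (enorm_add_le _ _).trans ?_
          rw [enorm_mul, enorm_mul, hJe]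
          exact add_le_add_right (mul_le_mul_left (hJ1 v) _) _
      _ ≤ ENNReal.ofReal (deformJacobian τ v) * (ENNReal.ofReal (deformConst t) * β) +
            ENNReal.ofReal (2 * t + 2 * t ^ 2) * β := by
          have hm : Measurable fun u => ‖W (v - u)‖ₑ :=
            (hWm.comp (measurable_const.sub measurable_id)).enorm
          rw [lintegral_add_right _ (hm.const_mul _),
            lintegral_const_mul' _ _ ENNReal.ofReal_ne_top,
            lintegral_const_mul' _ _ ENNReal.ofReal_ne_top]
          refine add_le_add (mul_le_mul_right ((hW.lintegral_deform_sub_left_le hτ ht ht1 v).trans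
            (mul_le_mul_right hWβ _)) _) (mul_le_mul_right ?_ _)
          rwa [lintegral_sub_left_eq_self (fun z => ‖W z‖ₑ)]
      _ ≤ ENNReal.ofReal (deformJacobian τ v) * (ENNReal.ofReal (deformConst t) * β +
          ENNReal.ofReal (2 * t + 2 * t ^ 2) *
            (ENNReal.ofReal (1 / (1 - 2 * t - 2 * t ^ 2)) * β)) := by
          rw [mul_add]
          refine add_le_add_right ?_ _
          rw [mul_left_comm]
          refine mul_le_mul_right ?_ _
          rw [← mul_assoc, ← ENNReal.ofReal_mul (hJ0 v)]
          refine le_mul_of_one_le_left zero_le ?_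
          rw [← ENNReal.ofReal_one]
          refine ENNReal.ofReal_le_ofReal ?_
          rw [mul_one_div, le_div_iff₀ hδ, one_mul]
          exact le_deformJacobian ht v
      _ ≤ _ := by
          rw [mul_comm]
          exact mul_le_mul_left hconst _

section FourierBessel

open scoped ContDiff

/-! ### Bessel functions -/

/-- The entire function `∑ (-s)^i / (i! (i + m)!)`, in terms of which
`J_m(x) = (x/2)^m · besselSeries m ((x/2)²)`. -/
noncomputable def besselSeries (m : ℕ) (s : ℝ) : ℝ :=
  ∑' i : ℕ, (-1 : ℝ) ^ i / ((i.factorial : ℝ) * ((i + m).factorial : ℝ)) * s ^ i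

lemma besselJ_eq (m : ℕ) (x : ℝ) : besselJ m x = (x / 2) ^ m * besselSeries m ((x / 2) ^ 2) := by
  rw [besselJ, besselSeries, ← tsum_mul_left]
  refine tsum_congr fun i => ?_
  rw [pow_add, pow_mul]
  ring

lemma norm_besselSeries_coeff_le (m i : ℕ) :
    ‖(-1 : ℝ) ^ i / ((i.factorial : ℝ) * ((i + m).factorial : ℝ))‖ ≤ 1 / (i.factorial : ℝ) := by
  have h1 : (0 : ℝ) < i.factorial := by exact_mod_cast i.factorial_pos
  have h2 : (1 : ℝ) ≤ (i + m).factorial := by exact_mod_cast (i + m).factorial_pos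
  rw [norm_div, norm_pow, norm_neg, norm_one, one_pow, norm_mul, Real.norm_of_nonneg h1.le,
    Real.norm_of_nonneg (by linarith)]
  exact one_div_le_one_div_of_le h1 (le_mul_of_one_le_right h1.le h2)

lemma summable_besselSeries (m : ℕ) (s : ℝ) : Summable fun i : ℕ =>
    (-1 : ℝ) ^ i / ((i.factorial : ℝ) * ((i + m).factorial : ℝ)) * s ^ i := by
  refine Summable.of_norm_bounded (Real.summable_pow_div_factorial |s|) fun i => ?_
  rw [norm_mul, norm_pow, Real.norm_eq_abs s, div_eq_mul_one_div (|s| ^ i), mul_comm]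
  exact mul_le_mul_of_nonneg_left (norm_besselSeries_coeff_le m i) (by positivity)

lemma hasDerivAt_besselSeries (m : ℕ) (s : ℝ) :
    HasDerivAt (besselSeries m) (-besselSeries (m + 1) s) s := by
  have hbound : Summable fun i : ℕ => (i : ℝ) * (|s| + 1) ^ (i - 1) / (i.factorial : ℝ) := by
    rw [← summable_nat_add_iff 1]
    refine (Real.summable_pow_div_factorial (|s| + 1)).congr fun i => ?_
    rw [Nat.add_sub_cancel, Nat.factorial_succ, Nat.cast_mul]
    field_simp
  have h := hasDerivAt_tsum_of_isPreconnected (𝕜 := ℝ) (F := ℝ)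
    (g := fun (i : ℕ) (s : ℝ) =>
      (-1 : ℝ) ^ i / ((i.factorial : ℝ) * ((i + m).factorial : ℝ)) * s ^ i)
    (g' := fun (i : ℕ) (s : ℝ) =>
      (-1 : ℝ) ^ i / ((i.factorial : ℝ) * ((i + m).factorial : ℝ)) * (i * s ^ (i - 1)))
    hbound (Metric.isOpen_ball (x := (0 : ℝ)) (ε := |s| + 1))
    (convex_ball (0 : ℝ) (|s| + 1)).isPreconnected
    (fun i y _ => (hasDerivAt_pow i y).const_mul _) (fun i y hy => ?_)
    (y₀ := 0) (by simp; positivity) (summable_besselSeries m 0)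
    (y := s) (by simp)
  · refine h.congr_deriv ?_
    have hs : Summable fun i : ℕ => (-1 : ℝ) ^ i /
        ((i.factorial : ℝ) * ((i + m).factorial : ℝ)) * (i * s ^ (i - 1)) := by
      rw [← summable_nat_add_iff 1]
      refine (summable_besselSeries (m + 1) s).neg.congr fun i => ?_
      rw [Nat.add_sub_cancel, Nat.factorial_succ, show i + 1 + m = i + (m + 1) by ring]
      push_cast
      field_simp
      ring
    rw [hs.tsum_eq_zero_add, besselSeries, ← tsum_neg]
    simp only [Nat.cast_zero, zero_mul, mul_zero, zero_add]
    refine tsum_congr fun i => ?_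
    rw [Nat.add_sub_cancel, Nat.factorial_succ, show i + 1 + m = i + (m + 1) by ring]
    push_cast
    field_simp
    ring
  · have hy' : |y| ≤ |s| + 1 := by
      rw [Metric.mem_ball, dist_zero_right, Real.norm_eq_abs] at hy; exact hy.le
    calc _ ≤ 1 / (i.factorial : ℝ) * ((i : ℝ) * (|s| + 1) ^ (i - 1)) := by
          rw [norm_mul]
          refine mul_le_mul (norm_besselSeries_coeff_le m i) ?_ (norm_nonneg _) (by positivity)
          rw [norm_mul, norm_pow, Real.norm_natCast, Real.norm_eq_abs]
          gcongr
      _ = _ := by ring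

lemma besselSeries_recurrence (m : ℕ) (s : ℝ) :
    s * besselSeries (m + 2) s - (m + 1) * besselSeries (m + 1) s + besselSeries m s = 0 := by
  have h0 := summable_besselSeries m s
  have h1 := (summable_besselSeries (m + 1) s).mul_left ((m : ℝ) + 1)
  have e : besselSeries m s - (m + 1) * besselSeries (m + 1) s = -(s * besselSeries (m + 2) s) := by
    rw [besselSeries, besselSeries, besselSeries, ← tsum_mul_left, ← tsum_mul_left, ← tsum_neg,
      ← h0.tsum_sub h1, (h0.sub h1).tsum_eq_zero_add]
    have hz : (-1 : ℝ) ^ 0 / (((0 : ℕ).factorial : ℝ) * ((0 + m).factorial : ℝ)) * s ^ 0 -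
        ((m : ℝ) + 1) * ((-1 : ℝ) ^ 0 /
          (((0 : ℕ).factorial : ℝ) * ((0 + (m + 1)).factorial : ℝ)) * s ^ 0) = 0 := by
      rw [zero_add, zero_add, Nat.factorial_succ]
      push_cast
      field_simp
      ring
    rw [hz, zero_add]
    refine tsum_congr fun i => ?_
    rw [show i + 1 + (m + 1) = (i + 1 + m) + 1 by ring, show i + (m + 2) = (i + 1 + m) + 1 by ring,
      Nat.factorial_succ (i + 1 + m), Nat.factorial_succ i]
    push_cast
    field_simp
    ring
  linarith

lemma contDiff_besselSeries (m : ℕ) : ContDiff ℝ ∞ (besselSeries m) := by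
  rw [contDiff_infty]
  intro n
  induction n generalizing m with
  | zero =>
    rw [Nat.cast_zero, contDiff_zero]
    exact (show Differentiable ℝ (besselSeries m) from
      fun s => (hasDerivAt_besselSeries m s).differentiableAt).continuous
  | succ n ih =>
    rw [Nat.cast_succ, contDiff_succ_iff_deriv]
    refine ⟨fun s => (hasDerivAt_besselSeries m s).differentiableAt, by simp, ?_⟩
    rw [show deriv (besselSeries m) = fun s => -besselSeries (m + 1) s from
      funext fun s => (hasDerivAt_besselSeries m s).deriv]
    exact (ih (m + 1)).neg

/-! ### Fourier-Bessel functions as smooth functions on the plane -/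

/-- The isometry `(u₀, u₁) ↦ u₀ + i u₁` of the plane onto `ℂ`. -/
noncomputable def planeToComplex : Plane ≃ₗᵢ[ℝ] ℂ := Complex.orthonormalBasisOneI.repr.symm

lemma planeToComplex_apply (u : Plane) : planeToComplex u = ⟨u 0, u 1⟩ := by
  rw [planeToComplex, ← OrthonormalBasis.sum_repr_symm, Fin.sum_univ_two]
  apply Complex.ext <;> simp

/-- The partial derivative of a function on the plane in the `i`-th coordinate direction. -/
noncomputable def partialDeriv (i : Fin 2) (F : Plane → ℝ) (u : Plane) : ℝ :=
  fderiv ℝ F u (EuclideanSpace.single i 1)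

lemma ContDiff.partialDeriv {F : Plane → ℝ} (hF : ContDiff ℝ ∞ F) (i : Fin 2) :
    ContDiff ℝ ∞ (partialDeriv i F) :=
  (hF.fderiv_right (m := ∞) (by simp)).clm_apply contDiff_const

lemma partialDeriv_eq_of_hasLineDerivAt {F : Plane → ℝ} (hF : Differentiable ℝ F) {i : Fin 2}
    {u : Plane} {d : ℝ} (h : HasLineDerivAt ℝ F d u (EuclideanSpace.single i 1)) :
    partialDeriv i F u = d := by
  rw [partialDeriv, ← (hF u).lineDeriv_eq_fderiv, h.lineDeriv]

/-- The function `J_m(R r) Re(w e^{imθ})` up to a constant factor, with `κ = R²/4`. -/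
noncomputable def besselHarmonic (m : ℕ) (κ : ℝ) (w : ℂ) (u : Plane) : ℝ :=
  besselSeries m (κ * ‖u‖ ^ 2) * (w * planeToComplex u ^ m).re

lemma contDiff_besselHarmonic (m : ℕ) (κ : ℝ) (w : ℂ) :
    ContDiff ℝ ∞ (besselHarmonic m κ w) := by
  unfold besselHarmonic
  refine ((contDiff_besselSeries m).comp (contDiff_const.mul (contDiff_norm_sq ℝ))).mul ?_
  exact Complex.reCLM.contDiff.comp
    (contDiff_const.mul ((planeToComplex.toContinuousLinearEquiv.contDiff).pow m))

lemma hasDerivAt_besselSeries_line (m : ℕ) (κ : ℝ) (u e : Plane) :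
    HasDerivAt (fun t : ℝ => besselSeries m (κ * ‖u + t • e‖ ^ 2))
      (-besselSeries (m + 1) (κ * ‖u‖ ^ 2) * (κ * (2 * inner ℝ u e))) 0 := by
  have h1 : HasDerivAt (fun t : ℝ => u + t • e) e 0 := by
    simpa using ((hasDerivAt_id (0 : ℝ)).smul_const e).const_add u
  have h2 : HasDerivAt (fun t : ℝ => κ * ‖u + t • e‖ ^ 2) (κ * (2 * inner ℝ u e)) 0 := by
    simpa using (h1.norm_sq).const_mul κ
  have h3 : HasDerivAt (besselSeries m) (-besselSeries (m + 1) (κ * ‖u‖ ^ 2))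
      (κ * ‖u + (0 : ℝ) • e‖ ^ 2) := by
    simpa using hasDerivAt_besselSeries m (κ * ‖u‖ ^ 2)
  exact h3.comp (0 : ℝ) h2

lemma hasDerivAt_re_pow_line (m : ℕ) (w : ℂ) (u e : Plane) :
    HasDerivAt (fun t : ℝ => (w * planeToComplex (u + t • e) ^ m).re)
      (w * (m * planeToComplex u ^ (m - 1) * planeToComplex e)).re 0 := by
  have h1 : HasDerivAt (fun t : ℝ => planeToComplex (u + t • e)) (planeToComplex e) 0 := by
    have : (fun t : ℝ => planeToComplex (u + t • e)) =
        fun t : ℝ => planeToComplex u + t • planeToComplex e := by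
      funext t; simp
    rw [this]
    simpa using ((hasDerivAt_id (0 : ℝ)).smul_const (planeToComplex e)).const_add (planeToComplex u)
  have h2 := (h1.pow m).const_mul w
  have h3 := Complex.reCLM.hasFDerivAt.comp_hasDerivAt (0 : ℝ) h2
  simp only [zero_smul, add_zero] at h3
  exact h3

lemma hasDerivAt_inner_line (u e : Plane) :
    HasDerivAt (fun t : ℝ => inner ℝ (u + t • e) e) (‖e‖ ^ 2) 0 := by
  have h1 : HasDerivAt (fun t : ℝ => u + t • e) e 0 := by
    simpa using ((hasDerivAt_id (0 : ℝ)).smul_const e).const_add u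
  simpa using h1.inner ℝ (hasDerivAt_const (0 : ℝ) e)

lemma partialDeriv_besselHarmonic (i : Fin 2) (m : ℕ) (κ : ℝ) (w : ℂ) :
    partialDeriv i (besselHarmonic m κ w) = fun u =>
      -besselSeries (m + 1) (κ * ‖u‖ ^ 2) * (κ * (2 * inner ℝ u (EuclideanSpace.single i 1))) *
          (w * planeToComplex u ^ m).re +
        besselSeries m (κ * ‖u‖ ^ 2) * (w * (m * planeToComplex u ^ (m - 1) *
          planeToComplex (EuclideanSpace.single i 1))).re := by
  funext u
  refine partialDeriv_eq_of_hasLineDerivAt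
    ((contDiff_besselHarmonic m κ w).differentiable (by simp)) ?_
  have h := (hasDerivAt_besselSeries_line m κ u (EuclideanSpace.single i 1)).mul
    (hasDerivAt_re_pow_line m w u (EuclideanSpace.single i 1))
  simp only [zero_smul, add_zero] at h
  exact h

lemma partialDeriv_partialDeriv_besselHarmonic (i : Fin 2) (m : ℕ) (κ : ℝ) (w : ℂ) (u : Plane) :
    partialDeriv i (partialDeriv i (besselHarmonic m κ w)) u =
      besselSeries (m + 2) (κ * ‖u‖ ^ 2) * (2 * κ * u i) ^ 2 * (w * planeToComplex u ^ m).re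
      - 2 * κ * besselSeries (m + 1) (κ * ‖u‖ ^ 2) * (w * planeToComplex u ^ m).re
      - 4 * κ * u i * besselSeries (m + 1) (κ * ‖u‖ ^ 2) * (w * (m * planeToComplex u ^ (m - 1) *
          planeToComplex (EuclideanSpace.single i 1))).re
      + besselSeries m (κ * ‖u‖ ^ 2) * (w * (m * ((m - 1 : ℕ) * planeToComplex u ^ (m - 1 - 1)) *
          planeToComplex (EuclideanSpace.single i 1) ^ 2)).re := by
  refine partialDeriv_eq_of_hasLineDerivAt
    (((contDiff_besselHarmonic m κ w).partialDeriv i).differentiable (by simp)) ?_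
  rw [partialDeriv_besselHarmonic]
  set e : Plane := EuclideanSpace.single i 1 with he
  have hue : ∀ v : Plane, inner ℝ v e = v i := fun v => by
    rw [he, EuclideanSpace.inner_single_right]; simp
  have hne : ‖e‖ = 1 := by simp [he]
  have h1 := (((hasDerivAt_besselSeries_line (m + 1) κ u e).neg.mul
    (((hasDerivAt_inner_line u e).const_mul 2).const_mul κ)).mul
    (hasDerivAt_re_pow_line m w u e)).add
    ((hasDerivAt_besselSeries_line m κ u e).mul
    (hasDerivAt_re_pow_line (m - 1) (w * m * planeToComplex e) u e))
  have e1 : ∀ z : ℂ, w * m * planeToComplex e * z = w * (m * z * planeToComplex e) := fun z => by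
    ring
  simp only [HasLineDerivAt]
  simp only [e1] at h1
  refine h1.congr_deriv ?_
  have e2 : (w * (m * ((m - 1 : ℕ) * planeToComplex u ^ (m - 1 - 1) * planeToComplex e) *
      planeToComplex e)) = w * (m * ((m - 1 : ℕ) * planeToComplex u ^ (m - 1 - 1)) *
          planeToComplex e ^ 2) := by ring
  simp only [zero_smul, add_zero, hue, hne, e2]
  generalize (w * (m * ((m - 1 : ℕ) * planeToComplex u ^ (m - 1 - 1)) *
          planeToComplex e ^ 2)).re = A
  simp only [Pi.neg_apply, Pi.mul_apply, zero_smul, add_zero]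
  ring

/-- The functions `J_m(R r) Re(w e^{imθ})` are eigenfunctions of the Laplacian, with eigenvalue
`-R² = -4κ`. -/
lemma laplacian_besselHarmonic (m : ℕ) (κ : ℝ) (w : ℂ) (u : Plane) :
    ∑ i, partialDeriv i (partialDeriv i (besselHarmonic m κ w)) u =
      -(4 * κ) * besselHarmonic m κ w u := by
  have hrec := besselSeries_recurrence m (κ * ‖u‖ ^ 2)
  simp only [Fin.sum_univ_two, partialDeriv_partialDeriv_besselHarmonic, besselHarmonic]
  have h0 : planeToComplex (EuclideanSpace.single 0 1) = 1 := by
    rw [planeToComplex_apply]; apply Complex.ext <;> simp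
  have h1 : planeToComplex (EuclideanSpace.single 1 1) = Complex.I := by
    rw [planeToComplex_apply]; apply Complex.ext <;> simp
  have hn : ‖u‖ ^ 2 = u 0 ^ 2 + u 1 ^ 2 := by
    rw [EuclideanSpace.norm_sq_eq, Fin.sum_univ_two, Real.norm_eq_abs, Real.norm_eq_abs, sq_abs,
      sq_abs]
  -- Euler's identity for the homogeneous polynomial `Re(w z^m)`
  have hEuler : u 0 * (w * (m * planeToComplex u ^ (m - 1) * 1)).re +
      u 1 * (w * (m * planeToComplex u ^ (m - 1) * Complex.I)).re =
      m * (w * planeToComplex u ^ m).re := by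
    have hz : planeToComplex u = u 0 + u 1 * Complex.I := by
      rw [planeToComplex_apply]; apply Complex.ext <;> simp
    have : ((m : ℝ) : ℂ) * (w * planeToComplex u ^ m) =
        ((u 0 : ℝ) : ℂ) * (w * (m * planeToComplex u ^ (m - 1) * 1)) +
        ((u 1 : ℝ) : ℂ) * (w * (m * planeToComplex u ^ (m - 1) * Complex.I)) := by
      rcases Nat.eq_zero_or_pos m with rfl | hm
      · simp
      · obtain ⟨n, rfl⟩ := Nat.exists_eq_succ_of_ne_zero hm.ne'
        rw [Nat.succ_sub_one, pow_succ]
        nth_rewrite 2 [hz]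
        push_cast
        ring
    rw [← Complex.re_ofReal_mul, ← Complex.re_ofReal_mul, ← Complex.re_ofReal_mul, this,
      Complex.add_re]
  rw [h0, h1, Complex.I_sq]
  have hA : (w * (m * ((m - 1 : ℕ) * planeToComplex u ^ (m - 1 - 1)) * (-1))).re =
      -(w * (m * ((m - 1 : ℕ) * planeToComplex u ^ (m - 1 - 1)) * 1 ^ 2)).re := by
    rw [← Complex.neg_re]; congr 1; ring
  rw [hA]
  generalize (w * (m * ((m - 1 : ℕ) * planeToComplex u ^ (m - 1 - 1)) * 1 ^ 2)).re = A
  generalize (w * (m * planeToComplex u ^ (m - 1) * 1)).re = B at hEuler ⊢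
  generalize (w * (m * planeToComplex u ^ (m - 1) * Complex.I)).re = D at hEuler ⊢
  generalize (w * planeToComplex u ^ m).re = H at hEuler ⊢
  generalize hS2 : besselSeries (m + 2) (κ * ‖u‖ ^ 2) = S2 at hrec ⊢
  generalize hS1 : besselSeries (m + 1) (κ * ‖u‖ ^ 2) = S1 at hrec ⊢
  generalize hS0 : besselSeries m (κ * ‖u‖ ^ 2) = S0 at hrec ⊢
  rw [hn] at hrec
  linear_combination 4 * κ * H * hrec - 4 * κ * S1 * hEuler

/-! ### Green's identity on the unit disk -/

/-- The restriction of a function to the closed unit disk, extended by zero. -/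
noncomputable def diskCutoff (F : Plane → ℝ) : Plane → ℝ := (Metric.closedBall 0 1).indicator F

lemma diskCutoff_of_norm_le {F : Plane → ℝ} {u : Plane} (hu : ‖u‖ ≤ 1) : diskCutoff F u = F u :=
  indicator_of_mem (by simpa using hu) F

lemma diskCutoff_of_one_lt_norm {F : Plane → ℝ} {u : Plane} (hu : 1 < ‖u‖) : diskCutoff F u = 0 :=
  indicator_of_notMem (by simpa using hu) F

lemma diskCutoff_eventuallyEq_of_norm_lt (F : Plane → ℝ) {u : Plane} (hu : ‖u‖ < 1) :
    diskCutoff F =ᶠ[𝓝 u] F := by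
  filter_upwards [continuous_norm.continuousAt.eventually_lt_const hu] with v hv
  exact diskCutoff_of_norm_le hv.le

lemma diskCutoff_eventuallyEq_of_one_lt_norm (F : Plane → ℝ) {u : Plane} (hu : 1 < ‖u‖) :
    diskCutoff F =ᶠ[𝓝 u] fun _ => 0 := by
  filter_upwards [continuous_norm.continuousAt.eventually_const_lt hu] with v hv
  exact diskCutoff_of_one_lt_norm hv

lemma exists_lipschitzOnWith_closedBall {F : Plane → ℝ} (hF : ContDiff ℝ ∞ F) :
    ∃ K, LipschitzOnWith K F (Metric.closedBall 0 1) :=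
  (hF.contDiffOn (s := Metric.closedBall 0 1)).exists_lipschitzOnWith (by simp)
    (convex_closedBall 0 1) (isCompact_closedBall 0 1)

/-- For a function vanishing on the unit circle the extension by zero from the disk is Lipschitz:
compare a point `v` outside the disk with `v / ‖v‖`. -/
lemma exists_lipschitzWith_diskCutoff {F : Plane → ℝ} (hF : ContDiff ℝ ∞ F)
    (h0 : ∀ u, ‖u‖ = 1 → F u = 0) : ∃ K, LipschitzWith K (diskCutoff F) := by
  obtain ⟨K, hK⟩ := exists_lipschitzOnWith_closedBall hF
  have hmix : ∀ u v : Plane, ‖u‖ ≤ 1 → 1 < ‖v‖ → |F u| ≤ 2 * K * ‖u - v‖ := by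
    intro u v hu hv
    have hv0 : ‖v‖ ≠ 0 := by linarith
    have hw : ‖‖v‖⁻¹ • v‖ = 1 := by rw [norm_smul, norm_inv, norm_norm, inv_mul_cancel₀ hv0]
    have h1 := hK.dist_le_mul u (by simpa using hu) (‖v‖⁻¹ • v) (by simp [hw])
    rw [h0 _ hw, Real.dist_eq, sub_zero, dist_eq_norm] at h1
    have h2 : ‖v - ‖v‖⁻¹ • v‖ = ‖v‖ - 1 := by
      have : v - ‖v‖⁻¹ • v = (1 - ‖v‖⁻¹) • v := by rw [sub_smul, one_smul]
      rw [this, norm_smul, Real.norm_of_nonneg, sub_mul, one_mul, inv_mul_cancel₀ hv0]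
      exact sub_nonneg.2 (inv_le_one_of_one_le₀ hv.le)
    have h3 : ‖v‖ - ‖u‖ ≤ ‖u - v‖ := by
      rw [norm_sub_rev]; exact norm_sub_norm_le v u
    have h4 : ‖u - ‖v‖⁻¹ • v‖ ≤ ‖u - v‖ + ‖v - ‖v‖⁻¹ • v‖ := norm_sub_le_norm_sub_add_norm_sub _ _ _
    have hK0 : (0 : ℝ) ≤ K := K.coe_nonneg
    calc |F u| ≤ K * ‖u - ‖v‖⁻¹ • v‖ := h1
      _ ≤ K * (2 * ‖u - v‖) := mul_le_mul_of_nonneg_left (by linarith) hK0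
      _ = _ := by ring
  refine ⟨2 * K, LipschitzWith.of_dist_le_mul fun u v => ?_⟩
  rw [Real.dist_eq, dist_eq_norm]
  push_cast
  rcases le_or_gt ‖u‖ 1 with hu | hu <;> rcases le_or_gt ‖v‖ 1 with hv | hv
  · rw [diskCutoff_of_norm_le hu, diskCutoff_of_norm_le hv]
    have h1 := hK.dist_le_mul u (by simpa using hu) v (by simpa using hv)
    rw [Real.dist_eq, dist_eq_norm] at h1
    refine h1.trans (mul_le_mul_of_nonneg_right ?_ (norm_nonneg _))
    have hK0 : (0 : ℝ) ≤ K := K.coe_nonneg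
    linarith
  · rw [diskCutoff_of_norm_le hu, diskCutoff_of_one_lt_norm hv, sub_zero]
    exact hmix u v hu hv
  · rw [diskCutoff_of_norm_le hv, diskCutoff_of_one_lt_norm hu, zero_sub, abs_neg, norm_sub_rev]
    exact hmix v u hv hu
  · rw [diskCutoff_of_one_lt_norm hu, diskCutoff_of_one_lt_norm hv, sub_zero, abs_zero]
    positivity

lemma hasCompactSupport_diskCutoff (F : Plane → ℝ) : HasCompactSupport (diskCutoff F) :=
  HasCompactSupport.intro (isCompact_closedBall 0 1) fun _ hu => indicator_of_notMem hu F

lemma isConvFilter_diskCutoff {F : Plane → ℝ} (hF : ContDiff ℝ ∞ F)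
    (h0 : ∀ u, ‖u‖ = 1 → F u = 0) : IsConvFilter (diskCutoff F) where
  lipschitz := exists_lipschitzWith_diskCutoff hF h0
  hasCompactSupport := hasCompactSupport_diskCutoff F
  differentiableAt := by
    refine ⟨1, fun z hz => ?_⟩
    rcases lt_or_gt_of_ne hz with h | h
    · exact (diskCutoff_eventuallyEq_of_norm_lt F h).differentiableAt_iff.2
        (hF.differentiable (by simp) z)
    · exact (diskCutoff_eventuallyEq_of_one_lt_norm F h).differentiableAt_iff.2
        (differentiableAt_const _)

lemma ae_norm_ne_one : ∀ᵐ u : Plane, ‖u‖ ≠ 1 := by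
  have h := Measure.addHaar_sphere (volume : Measure Plane) 0 1
  rw [← compl_mem_ae_iff] at h
  filter_upwards [h] with u hu
  simpa using hu

/-- Integration by parts on the disk against a function vanishing on the circle. No boundary term
has to be handled, since the extension by zero is a compactly supported Lipschitz function. -/
lemma integral_partialDeriv_mul_partialDeriv {F H : Plane → ℝ} (hF : ContDiff ℝ ∞ F)
    (h0 : ∀ u, ‖u‖ = 1 → F u = 0) (hH : ContDiff ℝ ∞ H) (i : Fin 2) :
    ∫ u in Metric.closedBall (0 : Plane) 1, partialDeriv i F u * partialDeriv i H u =
      -∫ u in Metric.closedBall (0 : Plane) 1, F u * partialDeriv i (partialDeriv i H) u := by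
  obtain ⟨K, hK⟩ := exists_lipschitzWith_diskCutoff hF h0
  obtain ⟨K', hK'⟩ := exists_lipschitzOnWith_closedBall (hH.partialDeriv i)
  obtain ⟨f, hf, hfe⟩ := hK'.extend_real
  have hfe' : ∀ u : Plane, ‖u‖ < 1 → f =ᶠ[𝓝 u] partialDeriv i H := fun u hu => by
    filter_upwards [continuous_norm.continuousAt.eventually_lt_const hu] with v hv
    exact (hfe (by simpa using hv.le)).symm
  have h := hf.integral_lineDeriv_mul_eq (μ := volume) hK (hasCompactSupport_diskCutoff F)
    (EuclideanSpace.single i 1)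
  have e1 : ∫ u, lineDeriv ℝ f u (EuclideanSpace.single i 1) * diskCutoff F u =
      ∫ u in Metric.closedBall (0 : Plane) 1, F u * partialDeriv i (partialDeriv i H) u := by
    rw [← integral_indicator measurableSet_closedBall]
    refine integral_congr_ae ?_
    filter_upwards [ae_norm_ne_one] with u hu
    rcases lt_or_gt_of_ne hu with h | h
    · rw [indicator_of_mem (by simpa using h.le), diskCutoff_of_norm_le h.le,
        (hfe' u h).lineDeriv_eq,
        ((hH.partialDeriv i).differentiable (by simp) u).lineDeriv_eq_fderiv, mul_comm]
      rfl
    · rw [indicator_of_notMem (by simpa using h), diskCutoff_of_one_lt_norm h, mul_zero]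
  have e2 : ∫ u, lineDeriv ℝ (diskCutoff F) u (-EuclideanSpace.single i 1) * f u =
      -∫ u in Metric.closedBall (0 : Plane) 1, partialDeriv i F u * partialDeriv i H u := by
    rw [← integral_indicator measurableSet_closedBall, ← integral_neg]
    refine integral_congr_ae ?_
    filter_upwards [ae_norm_ne_one] with u hu
    rcases lt_or_gt_of_ne hu with h | h
    · rw [indicator_of_mem (by simpa using h.le), lineDeriv_neg,
        (diskCutoff_eventuallyEq_of_norm_lt F h).lineDeriv_eq,
        (hF.differentiable (by simp) u).lineDeriv_eq_fderiv, ← hfe (by simpa using h.le), neg_mul]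
      rfl
    · rw [indicator_of_notMem (by simpa using h),
        (diskCutoff_eventuallyEq_of_one_lt_norm F h).lineDeriv_eq]
      rw [(differentiableAt_const (0 : ℝ)).lineDeriv_eq_fderiv]
      simp
  rw [e1, e2] at h
  rw [h, neg_neg]

lemma integrableOn_closedBall_mul {F H : Plane → ℝ} (hF : Continuous F) (hH : Continuous H) :
    IntegrableOn (fun u => F u * H u) (Metric.closedBall (0 : Plane) 1) :=
  (hF.mul hH).continuousOn.integrableOn_compact (isCompact_closedBall 0 1)

/-- Green's identity for a function vanishing on the unit circle. -/
lemma sum_integral_partialDeriv_mul {F H : Plane → ℝ} (hF : ContDiff ℝ ∞ F)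
    (h0 : ∀ u, ‖u‖ = 1 → F u = 0) (hH : ContDiff ℝ ∞ H) :
    ∑ i, ∫ u in Metric.closedBall (0 : Plane) 1, partialDeriv i F u * partialDeriv i H u =
      -∫ u in Metric.closedBall (0 : Plane) 1,
        F u * ∑ i, partialDeriv i (partialDeriv i H) u := by
  simp only [integral_partialDeriv_mul_partialDeriv hF h0 hH, Finset.sum_neg_distrib,
    Finset.mul_sum]
  rw [integral_finsetSum]
  exact fun i _ => integrableOn_closedBall_mul hF.continuous
    ((hH.partialDeriv i).partialDeriv i).continuous

/-- Dirichlet eigenfunctions with different eigenvalues are orthogonal. -/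
lemma integral_mul_eq_zero_of_laplacian {F H : Plane → ℝ} (hF : ContDiff ℝ ∞ F)
    (hF0 : ∀ u, ‖u‖ = 1 → F u = 0) (hH : ContDiff ℝ ∞ H) (hH0 : ∀ u, ‖u‖ = 1 → H u = 0)
    {a b : ℝ} (hab : a ≠ b) (ha : ∀ u, ∑ i, partialDeriv i (partialDeriv i F) u = -a * F u)
    (hb : ∀ u, ∑ i, partialDeriv i (partialDeriv i H) u = -b * H u) :
    ∫ u in Metric.closedBall (0 : Plane) 1, F u * H u = 0 := by
  have h1 := sum_integral_partialDeriv_mul hF hF0 hH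
  have h2 := sum_integral_partialDeriv_mul hH hH0 hF
  simp only [mul_comm (partialDeriv _ H _)] at h2
  rw [h1] at h2
  simp only [ha, hb] at h2
  have e1 : ∀ u, F u * (-b * H u) = -b * (F u * H u) := fun u => by ring
  have e2 : ∀ u, H u * (-a * F u) = -a * (F u * H u) := fun u => by ring
  simp only [e1, e2, integral_const_mul] at h2
  have h3 : (a - b) * ∫ u in Metric.closedBall (0 : Plane) 1, F u * H u = 0 := by linarith
  exact (mul_eq_zero.1 h3).resolve_left (sub_ne_zero.2 hab)

/-- The weighted variation of the extension by zero is controlled by the Dirichlet energy on the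
disk, by the Cauchy-Schwarz inequality and since the disk has area `π`. -/
lemma weightedVariation_diskCutoff_le {F : Plane → ℝ} (hF : ContDiff ℝ ∞ F) :
    weightedVariation (diskCutoff F) ≤ ENNReal.ofReal (Real.sqrt (Real.pi *
      ∑ i, ∫ u in Metric.closedBall (0 : Plane) 1, partialDeriv i F u * partialDeriv i F u)) := by
  set B := Metric.closedBall (0 : Plane) 1
  have hfc : Continuous (fderiv ℝ F) := hF.continuous_fderiv (by simp)
  have h1 : weightedVariation (diskCutoff F) ≤ ∫⁻ u in B, ‖fderiv ℝ F u‖ₑ := by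
    rw [weightedVariation, ← lintegral_indicator measurableSet_closedBall]
    refine lintegral_mono_ae ?_
    filter_upwards [ae_norm_ne_one] with u hu
    rcases lt_or_gt_of_ne hu with h | h
    · rw [indicator_of_mem (by simpa using h.le), variationDensity,
        (diskCutoff_eventuallyEq_of_norm_lt F h).fderiv_eq]
      refine mul_le_of_le_one_left zero_le ?_
      rw [← ofReal_norm, ← ENNReal.ofReal_one]
      exact ENNReal.ofReal_le_ofReal h.le
    · rw [indicator_of_notMem (by simpa using h), variationDensity,
        (diskCutoff_eventuallyEq_of_one_lt_norm F h).fderiv_eq, ← ofReal_norm (fderiv ℝ _ u)]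
      simp
  have hvol : volume B = ENNReal.ofReal Real.pi := by
    rw [EuclideanSpace.volume_closedBall_fin_two]
    simp
  have h2 := lintegral_mul_sq_le (μ := volume.restrict B) (k := 1) (f := fun u => ‖fderiv ℝ F u‖ₑ)
    measurable_one hfc.measurable.enorm
  simp only [Pi.one_apply, one_mul, lintegral_const, Measure.restrict_apply_univ, hvol] at h2
  have h3 : ∫⁻ u in B, ‖fderiv ℝ F u‖ₑ ^ 2 ≤
      ENNReal.ofReal (∑ i, ∫ u in B, partialDeriv i F u * partialDeriv i F u) := by
    have hi : ∀ i ∈ (Finset.univ : Finset (Fin 2)),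
        Integrable (fun u => partialDeriv i F u * partialDeriv i F u) (volume.restrict B) :=
      fun i _ => integrableOn_closedBall_mul (hF.partialDeriv i).continuous
        (hF.partialDeriv i).continuous
    rw [← integral_finsetSum _ hi, ofReal_integral_eq_lintegral_ofReal (integrable_finsetSum _ hi)
      (Eventually.of_forall fun u => Finset.sum_nonneg fun i _ => mul_self_nonneg _)]
    refine lintegral_mono fun u => ?_
    rw [← ofReal_norm, ← ENNReal.ofReal_pow (norm_nonneg _)]
    refine ENNReal.ofReal_le_ofReal ?_
    have hS : 0 ≤ ∑ i, partialDeriv i F u * partialDeriv i F u :=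
      Finset.sum_nonneg fun i _ => mul_self_nonneg _
    have hn : ‖fderiv ℝ F u‖ ≤ Real.sqrt (∑ i, partialDeriv i F u * partialDeriv i F u) := by
      refine ContinuousLinearMap.opNorm_le_bound _ (Real.sqrt_nonneg _) fun v => ?_
      have hv : fderiv ℝ F u v = ∑ i, v i * partialDeriv i F u := by
        conv_lhs => rw [← (EuclideanSpace.basisFun (Fin 2) ℝ).sum_repr v]
        simp [partialDeriv]
      rw [hv, EuclideanSpace.norm_eq, ← Real.sqrt_mul hS, Real.norm_eq_abs]
      refine Real.abs_le_sqrt ?_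
      have := Finset.sum_mul_sq_le_sq_mul_sq Finset.univ (fun i => v i)
        fun i => partialDeriv i F u
      simpa [sq_abs, mul_comm, ← sq] using this
    calc ‖fderiv ℝ F u‖ ^ 2 ≤ Real.sqrt (∑ i, partialDeriv i F u * partialDeriv i F u) ^ 2 :=
          pow_le_pow_left₀ (norm_nonneg _) hn 2
      _ = _ := Real.sq_sqrt hS
  have hE : 0 ≤ ∑ i, ∫ u in B, partialDeriv i F u * partialDeriv i F u :=
    Finset.sum_nonneg fun i _ => integral_nonneg fun u => mul_self_nonneg _
  refine h1.trans ((ENNReal.pow_le_pow_left_iff two_ne_zero).1 ?_)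
  refine (h2.trans (mul_le_mul_right h3 _)).trans_eq ?_
  rw [← ENNReal.ofReal_mul Real.pi_pos.le, ← ENNReal.ofReal_pow (Real.sqrt_nonneg _),
    Real.sq_sqrt (mul_nonneg Real.pi_pos.le hE)]

/-! ### The Fourier-Bessel basis -/

namespace FBIndex

/-- The smooth function on the whole plane whose restriction to the unit disk is `rawBasis k`. -/
noncomputable def smoothBasis (k : FBIndex) : Plane → ℝ :=
  besselHarmonic k.m.natAbs (k.R ^ 2 / 4)
    ((k.R / 2 : ℝ) ^ k.m.natAbs * (if 0 ≤ k.m then 1 else -Complex.I))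

lemma contDiff_smoothBasis (k : FBIndex) : ContDiff ℝ ∞ k.smoothBasis :=
  contDiff_besselHarmonic _ _ _

/-- The angular factor of a basis function. -/
noncomputable def angular (k : FBIndex) (θ : ℝ) : ℝ :=
  if 0 ≤ k.m then Real.cos ((k.m.natAbs : ℝ) * θ) else Real.sin ((k.m.natAbs : ℝ) * θ)

lemma smoothBasis_eq (k : FBIndex) (u : Plane) :
    k.smoothBasis u = besselJ k.m.natAbs (k.R * ‖u‖) * k.angular (polarAngle u) := by
  set n := k.m.natAbs with hn
  have hz : planeToComplex u ^ n =
      ((‖u‖ ^ n * Real.cos (n * polarAngle u) : ℝ) : ℂ) +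
        ((‖u‖ ^ n * Real.sin (n * polarAngle u) : ℝ) : ℂ) * Complex.I := by
    have h1 : polarAngle u = Complex.arg (planeToComplex u) := by
      rw [planeToComplex_apply, polarAngle]
    have h2 : ‖u‖ = ‖planeToComplex u‖ := (planeToComplex.norm_map u).symm
    conv_lhs => rw [← Complex.norm_mul_exp_arg_mul_I (planeToComplex u), mul_pow, ← h1, ← h2,
      ← Complex.exp_nat_mul, ← mul_assoc, Complex.exp_mul_I]
    push_cast
    ring
  rw [smoothBasis, besselHarmonic, besselJ_eq, angular, ← hn, hz]
  have hs : k.R ^ 2 / 4 * ‖u‖ ^ 2 = (k.R * ‖u‖ / 2) ^ 2 := by ring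
  have hp : (k.R * ‖u‖ / 2) ^ n = (k.R / 2) ^ n * ‖u‖ ^ n := by rw [← mul_pow]; ring
  rw [hs, hp]
  split_ifs
  · have hre : ∀ p a b : ℝ, ((p : ℂ) ^ n * 1 * ((a : ℂ) + (b : ℂ) * Complex.I)).re = p ^ n * a := by
      intro p a b
      rw [mul_one, ← Complex.ofReal_pow, Complex.re_ofReal_mul]
      simp
    rw [hre]; ring
  · have hre : ∀ p a b : ℝ,
        ((p : ℂ) ^ n * -Complex.I * ((a : ℂ) + (b : ℂ) * Complex.I)).re = p ^ n * b := by
      intro p a b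
      rw [← Complex.ofReal_pow, mul_assoc, Complex.re_ofReal_mul]
      simp
    rw [hre]; ring

lemma rawBasis_eq_diskCutoff (k : FBIndex) : k.rawBasis = diskCutoff k.smoothBasis := by
  funext u
  rcases le_or_gt ‖u‖ 1 with h | h
  · rw [diskCutoff_of_norm_le h, smoothBasis_eq, rawBasis, if_pos h, angular]
  · rw [diskCutoff_of_one_lt_norm h, rawBasis, if_neg h.not_ge]

lemma smoothBasis_eq_zero (k : FBIndex) (u : Plane) (hu : ‖u‖ = 1) : k.smoothBasis u = 0 := by
  rw [smoothBasis_eq, hu, mul_one, k.isZero.2.1, zero_mul]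

lemma laplacian_smoothBasis (k : FBIndex) (u : Plane) :
    ∑ i, partialDeriv i (partialDeriv i k.smoothBasis) u = -k.eigenvalue * k.smoothBasis u := by
  rw [smoothBasis, laplacian_besselHarmonic, eigenvalue]
  ring

/-- The radial frequency of an index is determined by `|m|` and `R`, as the number of zeros
in `(0, R]`. -/
lemma eq_of_eigenvalue_eq {k l : FBIndex} (hm : k.m = l.m) (he : k.eigenvalue = l.eigenvalue) :
    k = l := by
  have hR : k.R = l.R := by
    have := k.isZero.1
    have := l.isZero.1
    exact (pow_left_inj₀ (by linarith) (by linarith) two_ne_zero).1 he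
  have hk := k.isZero.2.2
  have hl := l.isZero.2.2
  rw [hm, hR, hl] at hk
  have hq : k.q = l.q := by exact_mod_cast hk.symm
  cases k; cases l; simp_all

lemma integral_cos_mul_eq_zero {c : ℝ} {n : ℤ} (hc : c = n) (hn : n ≠ 0) :
    ∫ θ in (-Real.pi)..Real.pi, Real.cos (c * θ) = 0 := by
  have hc0 : c ≠ 0 := by rw [hc]; exact_mod_cast hn
  rw [intervalIntegral.integral_comp_mul_left (fun x => Real.cos x) hc0, integral_cos, hc]
  simp [Real.sin_int_mul_pi]

lemma integral_angular_mul_angular {k l : FBIndex} (h : k.m ≠ l.m) :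
    ∫ θ in (-Real.pi)..Real.pi, k.angular θ * l.angular θ = 0 := by
  have hcs : ∀ a b : ℝ, ∫ θ in (-Real.pi)..Real.pi, Real.cos (a * θ) * Real.sin (b * θ) = 0 := by
    intro a b
    -- the integrand is odd
    have h := intervalIntegral.integral_comp_neg (a := -Real.pi) (b := Real.pi)
      fun θ => Real.cos (a * θ) * Real.sin (b * θ)
    simp only [mul_neg, Real.cos_neg, Real.sin_neg, neg_neg, intervalIntegral.integral_neg] at h
    linarith
  have hi : ∀ c : ℝ, IntervalIntegrable (fun θ => Real.cos (c * θ)) volume (-Real.pi) Real.pi :=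
    fun c => (by fun_prop : Continuous fun θ => Real.cos (c * θ)).intervalIntegrable _ _
  unfold angular
  split_ifs with hk hl hl
  · have e : ∀ θ : ℝ, Real.cos (k.m.natAbs * θ) * Real.cos (l.m.natAbs * θ) =
        (Real.cos (((k.m.natAbs : ℝ) - l.m.natAbs) * θ) +
          Real.cos (((k.m.natAbs : ℝ) + l.m.natAbs) * θ)) * (1 / 2) := fun θ => by
      rw [sub_mul (k.m.natAbs : ℝ), add_mul (k.m.natAbs : ℝ), Real.cos_sub, Real.cos_add]; ring
    simp only [e]
    rw [intervalIntegral.integral_mul_const, intervalIntegral.integral_add (hi _) (hi _),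
      integral_cos_mul_eq_zero (n := (k.m.natAbs : ℤ) - l.m.natAbs) (by simp) (by omega),
      integral_cos_mul_eq_zero (n := (k.m.natAbs : ℤ) + l.m.natAbs) (by simp) (by omega)]
    simp
  · exact hcs _ _
  · simp only [mul_comm (Real.sin _)]
    exact hcs _ _
  · have e : ∀ θ : ℝ, Real.sin (k.m.natAbs * θ) * Real.sin (l.m.natAbs * θ) =
        (Real.cos (((k.m.natAbs : ℝ) - l.m.natAbs) * θ) -
          Real.cos (((k.m.natAbs : ℝ) + l.m.natAbs) * θ)) * (1 / 2) := fun θ => by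
      rw [sub_mul (k.m.natAbs : ℝ), add_mul (k.m.natAbs : ℝ), Real.cos_sub, Real.cos_add]; ring
    simp only [e]
    rw [intervalIntegral.integral_mul_const, intervalIntegral.integral_sub (hi _) (hi _),
      integral_cos_mul_eq_zero (n := (k.m.natAbs : ℤ) - l.m.natAbs) (by simp) (by omega),
      integral_cos_mul_eq_zero (n := (k.m.natAbs : ℤ) + l.m.natAbs) (by simp) (by omega)]
    simp

/-- In polar coordinates the integral splits into a radial and an angular factor. -/
lemma integral_radial_mul_angular_eq_zero (g : ℝ → ℝ) (T : ℝ → ℝ)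
    (hT : ∫ θ in (-Real.pi)..Real.pi, T θ = 0) :
    ∫ u : Plane, g ‖u‖ * T (polarAngle u) = 0 := by
  have h1 : ∫ u : Plane, g ‖u‖ * T (polarAngle u) = ∫ z : ℂ, g ‖z‖ * T z.arg := by
    rw [← planeToComplex.measurePreserving.integral_comp
      planeToComplex.toHomeomorph.measurableEmbedding]
    refine integral_congr_ae (Eventually.of_forall fun u => ?_)
    simp only [LinearIsometryEquiv.norm_map]
    rw [planeToComplex_apply, polarAngle]
  rw [h1, ← Complex.integral_comp_polarCoord_symm]
  have h2 : ∫ p in polarCoord.target, p.1 • (g ‖Complex.polarCoord.symm p‖ *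
      T (Complex.polarCoord.symm p).arg) =
      ∫ p in Ioi (0 : ℝ) ×ˢ Ioo (-Real.pi) Real.pi, (p.1 * g p.1) * T p.2 := by
    rw [polarCoord_target]
    refine setIntegral_congr_fun (measurableSet_Ioi.prod measurableSet_Ioo) fun p hp => ?_
    obtain ⟨hr, hθ⟩ := hp
    simp only [mem_Ioi] at hr
    rw [Complex.norm_polarCoord_symm, abs_of_pos hr, Complex.polarCoord_symm_apply,
      Complex.ofReal_cos, Complex.ofReal_sin, Complex.arg_mul_cos_add_sin_mul_I hr
        ⟨hθ.1, hθ.2.le⟩, smul_eq_mul, mul_assoc]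
  rw [h2, Measure.volume_eq_prod, setIntegral_prod_mul (fun r => r * g r) T,
    ← integral_Ioc_eq_integral_Ioo (x := -Real.pi),
    ← intervalIntegral.integral_of_le (by linarith [Real.pi_pos]), hT, mul_zero]

lemma integral_smoothBasis_mul_of_ne {k l : FBIndex} (h : k ≠ l) :
    ∫ u in Metric.closedBall (0 : Plane) 1, k.smoothBasis u * l.smoothBasis u = 0 := by
  rcases eq_or_ne k.m l.m with hm | hm
  · have he : k.eigenvalue ≠ l.eigenvalue := fun he => h (eq_of_eigenvalue_eq hm he)
    exact integral_mul_eq_zero_of_laplacian k.contDiff_smoothBasis k.smoothBasis_eq_zero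
      l.contDiff_smoothBasis l.smoothBasis_eq_zero he k.laplacian_smoothBasis
      l.laplacian_smoothBasis
  · rw [← integral_indicator measurableSet_closedBall]
    rw [← integral_radial_mul_angular_eq_zero (fun r => if r ≤ 1 then
      besselJ k.m.natAbs (k.R * r) * besselJ l.m.natAbs (l.R * r) else 0) _
      (integral_angular_mul_angular hm)]
    refine integral_congr_ae (Eventually.of_forall fun u => ?_)
    rcases le_or_gt ‖u‖ 1 with hu | hu
    · simp only
      rw [indicator_of_mem (by simpa using hu), if_pos hu, smoothBasis_eq, smoothBasis_eq]
      ring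
    · simp only
      rw [indicator_of_notMem (by simpa using hu), if_neg hu.not_ge, zero_mul]

/-- The normalizing constant of a basis function. -/
noncomputable def normConst (k : FBIndex) : ℝ :=
  Real.sqrt (Real.pi / ∫ w : Plane, k.rawBasis w ^ 2)

/-- The basis functions satisfy `∫ ψ_k² ≤ π`. Only this inequality is needed, and it also covers the
value `0` of the normalizing constant for a vanishing integral. -/
lemma normConst_sq_mul_integral_le (k : FBIndex) :
    k.normConst ^ 2 * ∫ u in Metric.closedBall (0 : Plane) 1, k.smoothBasis u * k.smoothBasis u ≤
      Real.pi := by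
  have e : ∫ u in Metric.closedBall (0 : Plane) 1, k.smoothBasis u * k.smoothBasis u =
      ∫ w : Plane, k.rawBasis w ^ 2 := by
    rw [← integral_indicator measurableSet_closedBall, rawBasis_eq_diskCutoff]
    refine integral_congr_ae (Eventually.of_forall fun u => ?_)
    by_cases hu : u ∈ Metric.closedBall (0 : Plane) 1
    · simp only [diskCutoff, indicator_of_mem hu, sq]
    · simp [diskCutoff, indicator_of_notMem hu]
  have h0 : 0 ≤ ∫ w : Plane, k.rawBasis w ^ 2 := integral_nonneg fun w => sq_nonneg _
  rw [normConst, e, Real.sq_sqrt (div_nonneg Real.pi_pos.le h0)]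
  rcases h0.eq_or_lt with h | h
  · rw [← h, mul_zero]
    exact Real.pi_pos.le
  · rw [div_mul_cancel₀ _ h.ne']

end FBIndex

/-- The combination `∑ a_k ψ_k` as a smooth function on the whole plane. -/
noncomputable def fbSum (K : Finset FBIndex) (a : FBIndex → ℝ) (u : Plane) : ℝ :=
  ∑ k ∈ K, a k * k.normConst * k.smoothBasis u

lemma contDiff_fbSum (K : Finset FBIndex) (a : FBIndex → ℝ) : ContDiff ℝ ∞ (fbSum K a) :=
  ContDiff.sum fun k _ => contDiff_const.mul k.contDiff_smoothBasis

lemma fbSum_eq_zero (K : Finset FBIndex) (a : FBIndex → ℝ) (u : Plane) (hu : ‖u‖ = 1) :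
    fbSum K a u = 0 :=
  Finset.sum_eq_zero fun k _ => by rw [k.smoothBasis_eq_zero u hu, mul_zero]

lemma partialDeriv_sum (i : Fin 2) {ι : Type*} (K : Finset ι) (c : ι → ℝ) (f : ι → Plane → ℝ)
    (hf : ∀ k ∈ K, Differentiable ℝ (f k)) :
    partialDeriv i (fun u => ∑ k ∈ K, c k * f k u) =
      fun u => ∑ k ∈ K, c k * partialDeriv i (f k) u := by
  funext u
  unfold partialDeriv
  rw [fderiv_fun_sum fun k hk => ((hf k hk) u).const_mul (c k)]
  rw [_root_.sum_apply]
  refine Finset.sum_congr rfl fun k hk => ?_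
  rw [fderiv_const_mul ((hf k hk) u)]
  rfl

lemma laplacian_fbSum (K : Finset FBIndex) (a : FBIndex → ℝ) (u : Plane) :
    ∑ i, partialDeriv i (partialDeriv i (fbSum K a)) u =
      -∑ k ∈ K, a k * k.normConst * k.eigenvalue * k.smoothBasis u := by
  have h : ∀ i, partialDeriv i (partialDeriv i (fbSum K a)) u =
      ∑ k ∈ K, a k * k.normConst * partialDeriv i (partialDeriv i k.smoothBasis) u := fun i => by
    have h1 : partialDeriv i (fbSum K a) =
        fun u => ∑ k ∈ K, a k * k.normConst * partialDeriv i k.smoothBasis u :=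
      partialDeriv_sum i K (fun k => a k * k.normConst) FBIndex.smoothBasis
        fun k _ => k.contDiff_smoothBasis.differentiable (by simp)
    rw [h1, partialDeriv_sum i K (fun k => a k * k.normConst)
      (fun k => partialDeriv i k.smoothBasis)
      fun k _ => (k.contDiff_smoothBasis.partialDeriv i).differentiable (by simp)]
  simp only [h]
  rw [Finset.sum_comm, ← Finset.sum_neg_distrib]
  refine Finset.sum_congr rfl fun k _ => ?_
  rw [← Finset.mul_sum, k.laplacian_smoothBasis]
  ring

/-- The Dirichlet energy of `∑ a_k ψ_k` is at most `π ‖a‖_FB²`, the basis functions being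
orthogonal eigenfunctions of the Dirichlet Laplacian. -/
lemma energy_fbSum_le (K : Finset FBIndex) (a : FBIndex → ℝ) :
    ∑ i, ∫ u in Metric.closedBall (0 : Plane) 1,
      partialDeriv i (fbSum K a) u * partialDeriv i (fbSum K a) u ≤
      Real.pi * ∑ k ∈ K, k.eigenvalue * a k ^ 2 := by
  rw [sum_integral_partialDeriv_mul (contDiff_fbSum K a) (fbSum_eq_zero K a) (contDiff_fbSum K a)]
  have hi : ∀ k l : FBIndex, IntegrableOn (fun u => k.smoothBasis u * l.smoothBasis u)
      (Metric.closedBall (0 : Plane) 1) := fun k l =>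
    integrableOn_closedBall_mul k.contDiff_smoothBasis.continuous l.contDiff_smoothBasis.continuous
  have e : ∀ u, fbSum K a u * ∑ i, partialDeriv i (partialDeriv i (fbSum K a)) u =
      -∑ k ∈ K, ∑ l ∈ K, (a k * k.normConst * (a l * l.normConst * l.eigenvalue)) *
        (k.smoothBasis u * l.smoothBasis u) := fun u => by
    rw [laplacian_fbSum, mul_neg, fbSum, Finset.sum_mul_sum]
    congr 1
    exact Finset.sum_congr rfl fun k _ => Finset.sum_congr rfl fun l _ => by ring
  simp only [e]
  rw [integral_neg, neg_neg, integral_finsetSum _ fun k _ =>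
    integrable_finsetSum _ fun l _ => (hi k l).const_mul _, Finset.mul_sum]
  refine Finset.sum_le_sum fun k hk => ?_
  rw [integral_finsetSum _ fun l _ => (hi k l).const_mul _,
    Finset.sum_eq_single_of_mem k hk fun l _ hlk => by
      rw [integral_const_mul, FBIndex.integral_smoothBasis_mul_of_ne hlk.symm, mul_zero],
    integral_const_mul]
  have h := mul_le_mul_of_nonneg_left k.normConst_sq_mul_integral_le
    (show 0 ≤ k.eigenvalue * a k ^ 2 from mul_nonneg (sq_nonneg _) (sq_nonneg _))
  linarith

lemma weightedVariation_fbSum_le (K : Finset FBIndex) (a : FBIndex → ℝ) :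
    weightedVariation (diskCutoff (fbSum K a)) ≤ ENNReal.ofReal (Real.pi * fbNorm K a) := by
  refine (weightedVariation_diskCutoff_le (contDiff_fbSum K a)).trans (ENNReal.ofReal_le_ofReal ?_)
  rw [fbNorm, ← Real.sqrt_sq Real.pi_pos.le, ← Real.sqrt_mul (sq_nonneg _), Real.sqrt_sq
    Real.pi_pos.le]
  refine Real.sqrt_le_sqrt ?_
  rw [sq, mul_assoc]
  exact mul_le_mul_of_nonneg_left (energy_fbSum_le K a) Real.pi_pos.le

lemma IsConvFilter.rescale {W : Plane → ℝ} (hW : IsConvFilter W) {c : ℝ} (hc : 0 < c) :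
    IsConvFilter fun u => c ^ 2 * W (c • u) where
  lipschitz := by
    obtain ⟨K, hK⟩ := hW.lipschitz
    refine ⟨Real.toNNReal (c ^ 2 * (K * c)), LipschitzWith.of_dist_le_mul fun u v => ?_⟩
    have h := hK.dist_le_mul (c • u) (c • v)
    rw [dist_smul₀, Real.norm_of_nonneg hc.le, Real.dist_eq] at h
    rw [Real.coe_toNNReal _ (by positivity), Real.dist_eq, ← mul_sub, abs_mul,
      abs_of_pos (by positivity : 0 < c ^ 2), mul_assoc, mul_assoc]
    exact mul_le_mul_of_nonneg_left h (by positivity)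
  hasCompactSupport := (hW.hasCompactSupport.comp_smul hc.ne').mul_left
  differentiableAt := by
    obtain ⟨r, hr⟩ := hW.differentiableAt
    refine ⟨c⁻¹ * r, fun z hz => ?_⟩
    have hz' : ‖c • z‖ ≠ r := fun h => hz (by
      rw [← h, norm_smul, Real.norm_of_nonneg hc.le, inv_mul_cancel_left₀ hc.ne'])
    exact ((hr _ hz').comp z (differentiableAt_id.const_smul c)).const_mul _

lemma weightedVariation_rescale (W : Plane → ℝ) {c : ℝ} (hc : 0 < c) :
    weightedVariation (fun u => c ^ 2 * W (c • u)) = weightedVariation W := by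
  have h : ∀ z, variationDensity (fun u => c ^ 2 * W (c • u)) z =
      ENNReal.ofReal (c ^ 2) * variationDensity W (c • z) := fun z => by
    have hf : fderiv ℝ (fun u => c ^ 2 * W (c • u)) z = (c ^ 2 * c) • fderiv ℝ W (c • z) := by
      rw [show (fun u => c ^ 2 * W (c • u)) = (c ^ 2) • fun u => W (c • u) from rfl,
        fderiv_const_smul_field, Pi.smul_apply, fderiv_comp_smul, smul_smul]
    rw [variationDensity, variationDensity, hf, enorm_smul, enorm_smul, Real.enorm_of_nonneg hc.le,
      Real.enorm_of_nonneg (by positivity), ENNReal.ofReal_mul (by positivity)]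
    ring
  rw [weightedVariation, weightedVariation]
  simp only [h]
  rw [lintegral_const_mul' _ _ ENNReal.ofReal_ne_top, lintegral_comp_smul_plane hc, ← mul_assoc,
    ← ENNReal.ofReal_mul (by positivity), mul_inv_cancel₀ (by positivity), ENNReal.ofReal_one,
    one_mul]

namespace DCFNet

lemma filter_eq (N : DCFNet) (l : ℕ) (c' : Fin (N.M l)) (c : Fin (N.M (l + 1))) :
    N.filter l c' c = fun u => ((2 : ℝ) ^ (-N.j l)) ^ 2 *
      diskCutoff (fbSum (N.K l) (N.a l c' c)) ((2 : ℝ) ^ (-N.j l) • u) := by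
  have hd : ∀ v, diskCutoff (fbSum (N.K l) (N.a l c' c)) v =
      ∑ k ∈ N.K l, N.a l c' c k * k.basis v := fun v => by
    rcases le_or_gt ‖v‖ 1 with h | h
    · rw [diskCutoff_of_norm_le h, fbSum]
      refine Finset.sum_congr rfl fun k _ => ?_
      rw [FBIndex.basis, FBIndex.rawBasis_eq_diskCutoff, diskCutoff_of_norm_le h,
        ← FBIndex.rawBasis_eq_diskCutoff, ← FBIndex.normConst, mul_assoc]
    · rw [diskCutoff_of_one_lt_norm h]
      refine (Finset.sum_eq_zero fun k _ => ?_).symm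
      rw [FBIndex.basis, FBIndex.rawBasis, if_neg h.not_ge, mul_zero, mul_zero]
  funext u
  rw [hd, filter, Finset.mul_sum]
  refine Finset.sum_congr rfl fun k _ => ?_
  rw [FBIndex.scaledBasis, ← zpow_natCast, ← zpow_mul]
  rw [show -N.j l * ((2 : ℕ) : ℤ) = -2 * N.j l by push_cast; ring]
  ring

lemma isConvFilter_filter (N : DCFNet) (l : ℕ) (c' : Fin (N.M l)) (c : Fin (N.M (l + 1))) :
    IsConvFilter (N.filter l c' c) := by
  rw [filter_eq]
  exact (isConvFilter_diskCutoff (contDiff_fbSum _ _) (fbSum_eq_zero _ _)).rescale (by positivity)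

lemma weightedVariation_filter_le (N : DCFNet) (l : ℕ) (c' : Fin (N.M l))
    (c : Fin (N.M (l + 1))) :
    weightedVariation (N.filter l c' c) ≤
      ENNReal.ofReal (Real.pi * fbNorm (N.K l) (N.a l c' c)) := by
  rw [filter_eq, weightedVariation_rescale _ (by positivity)]
  exact weightedVariation_fbSum_le _ _

end DCFNet

end FourierBessel

/-! ### Signals with several channels -/

/-- The normalized norm `((1/M) ∑_c ‖x(·, c)‖₂²)^{1/2}`, with values in `[0, ∞]` and without the
factor `1/|Ω|`. -/
noncomputable def channelNorm {M : ℕ} (x : Signal M) : ℝ≥0∞ :=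
  ((M : ℝ≥0∞)⁻¹ * ∑ c, eLpNorm (x c) 2 volume ^ 2) ^ (1 / 2 : ℝ)

lemma channelNorm_sq {M : ℕ} (x : Signal M) :
    channelNorm x ^ 2 = (M : ℝ≥0∞)⁻¹ * ∑ c, eLpNorm (x c) 2 volume ^ 2 := by
  rw [channelNorm, ← ENNReal.rpow_natCast, ← ENNReal.rpow_mul]
  norm_num

lemma channelNorm_le_of_sq_le {M M' : ℕ} {x : Signal M} {y : Signal M'} {a : ℝ≥0∞}
    (h : (M : ℝ≥0∞)⁻¹ * ∑ c, eLpNorm (x c) 2 volume ^ 2 ≤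
      a ^ 2 * ((M' : ℝ≥0∞)⁻¹ * ∑ c, eLpNorm (y c) 2 volume ^ 2)) :
    channelNorm x ≤ a * channelNorm y := by
  rw [← channelNorm_sq, ← channelNorm_sq, ← mul_pow] at h
  exact (ENNReal.pow_le_pow_left_iff two_ne_zero).1 h

lemma channelNorm_add_le {M : ℕ} {x y : Signal M}
    (hx : ∀ c, AEStronglyMeasurable (x c) volume) (hy : ∀ c, AEStronglyMeasurable (y c) volume) :
    channelNorm (x + y) ≤ channelNorm x + channelNorm y := by
  have h := ENNReal.Lp_add_le Finset.univ (fun c => eLpNorm (x c) 2 volume)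
    (fun c => eLpNorm (y c) 2 volume) one_le_two
  simp only [channelNorm, ENNReal.mul_rpow_of_nonneg _ _ (by norm_num : (0 : ℝ) ≤ 1 / 2)]
  rw [← mul_add]
  refine mul_le_mul_right (le_trans (b := (∑ c, (eLpNorm (x c) 2 volume +
    eLpNorm (y c) 2 volume) ^ 2) ^ (1 / 2 : ℝ)) ?_ ?_) _
  · refine ENNReal.rpow_le_rpow (Finset.sum_le_sum fun c _ => pow_le_pow_left' ?_ 2) (by norm_num)
    exact eLpNorm_add_le (hx c) (hy c) one_le_two
  · simpa only [ENNReal.rpow_two] using h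

lemma memLp_of_channelNorm_lt_top {M : ℕ} {x : Signal M}
    (hx : ∀ c, AEStronglyMeasurable (x c) volume) (h : channelNorm x < ∞) (c : Fin M) :
    MemLp (x c) 2 volume := by
  refine ⟨hx c, ?_⟩
  have h2 : channelNorm x ^ 2 < ∞ := ENNReal.pow_lt_top h
  rw [channelNorm_sq] at h2
  by_contra hc
  rw [not_lt_top_iff] at hc
  have hs : ∑ c, eLpNorm (x c) 2 volume ^ 2 = ∞ :=
    ENNReal.sum_eq_top.2 ⟨c, Finset.mem_univ c, by simp [hc]⟩
  rw [hs, ENNReal.mul_top (ENNReal.inv_ne_zero.2 (ENNReal.natCast_ne_top M))] at h2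
  exact lt_irrefl _ h2

lemma channelNorm_lt_top {M : ℕ} (hM : 0 < M) {x : Signal M} (hx : ∀ c, MemLp (x c) 2 volume) :
    channelNorm x < ∞ := by
  refine ENNReal.rpow_lt_top_of_nonneg (by norm_num : (0 : ℝ) ≤ 1 / 2)
    (ENNReal.mul_ne_top ?_ ?_)
  · exact ENNReal.inv_ne_top.2 (by exact_mod_cast hM.ne')
  · exact (ENNReal.sum_lt_top.2 fun c _ => ENNReal.pow_lt_top (hx c).2).ne

lemma signalNorm_eq (J : ℤ) {M : ℕ} {x : Signal M} (hx : ∀ c, MemLp (x c) 2 volume) :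
    signalNorm J x = (channelNorm x).toReal / (2 * (2 : ℝ) ^ J) := by
  have h1 : ∀ c, ∫ u, |x c u| ^ 2 = (eLpNorm (x c) 2 volume ^ 2).toReal := fun c => by
    simp only [← Real.norm_eq_abs]
    rw [eLpNorm_two_sq, integral_eq_lintegral_of_nonneg_ae
      (Eventually.of_forall fun u => sq_nonneg _) ((hx c).1.norm.pow 2)]
    congr 1
    refine lintegral_congr fun u => ?_
    rw [ENNReal.ofReal_pow (norm_nonneg _), ofReal_norm]
  have h2 : (channelNorm x).toReal ^ 2 =
      1 / (M : ℝ) * ∑ c, (eLpNorm (x c) 2 volume ^ 2).toReal := by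
    rw [← ENNReal.toReal_pow, channelNorm_sq, ENNReal.toReal_mul, ENNReal.toReal_inv,
      ENNReal.toReal_natCast, ENNReal.toReal_sum fun c _ => (ENNReal.pow_lt_top (hx c).2).ne,
      one_div]
  rw [signalNorm]
  have hp : (0 : ℝ) < 2 * (2 : ℝ) ^ J := by positivity
  have h3 : 1 / (M : ℝ) * ∑ c, 1 / (2 * (2 : ℝ) ^ J) ^ 2 * ∫ u, |x c u| ^ 2 =
      ((channelNorm x).toReal / (2 * (2 : ℝ) ^ J)) ^ 2 := by
    rw [div_pow, h2, ← Finset.mul_sum]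
    simp only [h1]
    ring
  rw [h3, Real.sqrt_sq (by positivity)]

/-- Schur's test for the matrix of the operator norms between the channels. -/
lemma channelNorm_le_of_schur {M M' : ℕ} (hM' : 0 < M') {x : Signal M'}
    {y : Signal M} {β : Fin M' → Fin M → ℝ≥0∞} {a : ℝ≥0∞}
    (hrow : ∀ c, ∑ c', β c' c ≤ 1) (hcol : ∀ c', (M' : ℝ≥0∞) * (M : ℝ≥0∞)⁻¹ * ∑ c, β c' c ≤ 1)
    (h : ∀ c, eLpNorm (y c) 2 volume ≤ a * ∑ c', β c' c * eLpNorm (x c') 2 volume) :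
    channelNorm y ≤ a * channelNorm x := by
  refine channelNorm_le_of_sq_le ?_
  have hM'0 : (M' : ℝ≥0∞) ≠ 0 := by exact_mod_cast hM'.ne'
  have h1 : ∀ c, eLpNorm (y c) 2 volume ^ 2 ≤
      a ^ 2 * ∑ c', β c' c * eLpNorm (x c') 2 volume ^ 2 := fun c => by
    have hCS := lintegral_mul_sq_le (μ := Measure.count (α := Fin M')) (k := fun c' => β c' c)
      (f := fun c' => eLpNorm (x c') 2 volume) (measurable_of_countable _)
      (measurable_of_countable _)
    simp only [lintegral_count, tsum_fintype] at hCS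
    refine (pow_le_pow_left' (h c) 2).trans ?_
    rw [mul_pow]
    refine mul_le_mul_right (hCS.trans ?_) _
    exact mul_le_of_le_one_left zero_le (hrow c)
  have hcol' : ∀ c', (M : ℝ≥0∞)⁻¹ * ∑ c, β c' c ≤ (M' : ℝ≥0∞)⁻¹ := fun c' => by
    rw [ENNReal.le_inv_iff_mul_le, mul_comm, ← mul_assoc]
    exact hcol c'
  calc (M : ℝ≥0∞)⁻¹ * ∑ c, eLpNorm (y c) 2 volume ^ 2
      ≤ (M : ℝ≥0∞)⁻¹ * ∑ c, a ^ 2 * ∑ c', β c' c * eLpNorm (x c') 2 volume ^ 2 :=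
        mul_le_mul_right (Finset.sum_le_sum fun c _ => h1 c) _
    _ = a ^ 2 * ∑ c', ((M : ℝ≥0∞)⁻¹ * ∑ c, β c' c) * eLpNorm (x c') 2 volume ^ 2 := by
        rw [← Finset.mul_sum, Finset.sum_comm, mul_left_comm, Finset.mul_sum]
        congr 1
        refine Finset.sum_congr rfl fun c' _ => ?_
        rw [← Finset.sum_mul, mul_assoc]
    _ ≤ a ^ 2 * ∑ c', (M' : ℝ≥0∞)⁻¹ * eLpNorm (x c') 2 volume ^ 2 :=
        mul_le_mul_right (Finset.sum_le_sum fun c' _ => mul_le_mul_left (hcol' c') _) _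
    _ = _ := by rw [← Finset.mul_sum]

/-! ### One convolutional layer -/

/-- Every channel of the signal differs from a constant by a square-integrable function. The hidden
layers of a network with biases have this property, but need not be square integrable. -/
def IsL2UpToConst {M : ℕ} (x : Signal M) : Prop :=
  ∀ c, ∃ a : ℝ, MemLp (fun u => x c u - a) 2 volume

namespace IsL2UpToConst

variable {M : ℕ} {x : Signal M}

lemma locallyIntegrable (hx : IsL2UpToConst x) (c : Fin M) : LocallyIntegrable (x c) := by
  obtain ⟨a, ha⟩ := hx c
  have h := (ha.locallyIntegrable (by norm_num)).add (locallyIntegrable_const a)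
  have e : x c = (fun u => x c u - a) + fun _ => a := by
    funext u; simp
  rwa [e]

lemma aestronglyMeasurable (hx : IsL2UpToConst x) (c : Fin M) :
    AEStronglyMeasurable (x c) volume := (hx.locallyIntegrable c).aestronglyMeasurable

lemma deform (hx : IsL2UpToConst x) {τ : Plane → Plane} (hτ : Differentiable ℝ τ) {t : ℝ}
    (ht : ∀ u, ‖fderiv ℝ τ u‖ ≤ t) (ht1 : t ≤ 1 / 5) : IsL2UpToConst (deform τ x) := fun c => by
  obtain ⟨a, ha⟩ := hx c
  exact ⟨a, MemLp.comp_deform hτ ht ht1 ha⟩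

end IsL2UpToConst

lemma convLayer_apply (σ : ℝ → ℝ) {M' M : ℕ} (W : Fin M' → Fin M → Plane → ℝ) (b : Fin M → ℝ)
    (x : Signal M') (c : Fin M) (u : Plane) :
    convLayer σ W b x c u = σ ((∑ c', correlate (W c' c) (x c') u) + b c) := rfl

lemma correlate_sub {W : Plane → ℝ} (hW : IsConvFilter W) {x y : Plane → ℝ}
    (hx : LocallyIntegrable x) (hy : LocallyIntegrable y) (u : Plane) :
    correlate W (fun u => x u - y u) u = correlate W x u - correlate W y u := by
  rw [correlate, correlate, correlate, ← integral_sub (hW.integrable_mul_add hx u)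
    (hW.integrable_mul_add hy u)]
  simp only [mul_sub]

lemma correlate_const (W : Plane → ℝ) (a : ℝ) (u : Plane) :
    correlate W (fun _ => a) u = (∫ v, W v) * a := integral_mul_const a W

section Layer

variable {σ : ℝ → ℝ} {M M' : ℕ} {W : Fin M' → Fin M → Plane → ℝ} {b : Fin M → ℝ}
  {β : Fin M' → Fin M → ℝ≥0∞}

lemma aestronglyMeasurable_convLayer (hσ : LipschitzWith 1 σ)
    (hW : ∀ c' c, IsConvFilter (W c' c)) {x : Signal M'}
    (hx : ∀ c', AEStronglyMeasurable (x c') volume) (c : Fin M) :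
    AEStronglyMeasurable (convLayer σ W b x c) volume := by
  have h : AEStronglyMeasurable (fun u => (∑ c', correlate (W c' c) (x c') u) + b c) volume :=
    (Finset.aestronglyMeasurable_fun_sum _ fun c' _ =>
      aestronglyMeasurable_correlate (hW c' c) (hx c')).add aestronglyMeasurable_const
  exact hσ.continuous.comp_aestronglyMeasurable h

lemma eLpNorm_sum_le_of_le {f : Fin M' → Plane → ℝ} {x : Signal M'} {γ : Fin M' → ℝ≥0∞} {a : ℝ≥0∞}
    (hf : ∀ c', AEStronglyMeasurable (f c') volume)
    (h : ∀ c', eLpNorm (f c') 2 volume ≤ a * γ c' * eLpNorm (x c') 2 volume) :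
    eLpNorm (fun u => ∑ c', f c' u) 2 volume ≤ a * ∑ c', γ c' * eLpNorm (x c') 2 volume := by
  have e : (fun u => ∑ c', f c' u) = ∑ c', f c' := by
    funext u; rw [Finset.sum_apply]
  rw [e, Finset.mul_sum]
  refine (eLpNorm_sum_le (fun c' _ => hf c') one_le_two).trans (Finset.sum_le_sum fun c' _ => ?_)
  rw [← mul_assoc]
  exact h c'

/-- A layer is non-expansive. -/
lemma channelNorm_convLayer_sub_le (hσ : LipschitzWith 1 σ)
    (hW : ∀ c' c, IsConvFilter (W c' c)) (hβ : ∀ c' c, β c' c ≠ ∞)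
    (hWβ : ∀ c' c, weightedVariation (W c' c) ≤ β c' c) (hM' : 0 < M')
    (hrow : ∀ c, ∑ c', β c' c ≤ 1) (hcol : ∀ c', (M' : ℝ≥0∞) * (M : ℝ≥0∞)⁻¹ * ∑ c, β c' c ≤ 1)
    {x y : Signal M'} (hx : IsL2UpToConst x) (hy : IsL2UpToConst y) :
    channelNorm (convLayer σ W b x - convLayer σ W b y) ≤ channelNorm (x - y) := by
  rw [← one_mul (channelNorm (x - y))]
  refine channelNorm_le_of_schur hM' hrow hcol fun c => ?_
  have hxy : ∀ c', AEStronglyMeasurable (fun u => x c' u - y c' u) volume := fun c' =>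
    (hx.aestronglyMeasurable c').sub (hy.aestronglyMeasurable c')
  refine le_trans (eLpNorm_mono fun u => ?_) (eLpNorm_sum_le_of_le (a := 1)
    (f := fun c' => correlate (W c' c) fun u => x c' u - y c' u)
    (fun c' => aestronglyMeasurable_correlate (hW c' c) (hxy c')) fun c' => ?_)
  · have h := hσ.dist_le_mul ((∑ c', correlate (W c' c) (x c') u) + b c)
      ((∑ c', correlate (W c' c) (y c') u) + b c)
    rw [NNReal.coe_one, one_mul, dist_add_right, dist_eq_norm, dist_eq_norm,
      ← Finset.sum_sub_distrib] at h
    simp only [correlate_sub (hW _ c) (hx.locallyIntegrable _) (hy.locallyIntegrable _)]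
    exact h
  · rw [one_mul]
    exact (hW c' c).eLpNorm_correlate_le (hβ c' c) (hWβ c' c) (hxy c')

/-- The commutator of a layer with a deformation. -/
lemma channelNorm_deform_convLayer_sub_le (hσ : LipschitzWith 1 σ)
    (hW : ∀ c' c, IsConvFilter (W c' c)) (hβ : ∀ c' c, β c' c ≠ ∞)
    (hWβ : ∀ c' c, weightedVariation (W c' c) ≤ β c' c) (hM' : 0 < M')
    (hrow : ∀ c, ∑ c', β c' c ≤ 1) (hcol : ∀ c', (M' : ℝ≥0∞) * (M : ℝ≥0∞)⁻¹ * ∑ c, β c' c ≤ 1)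
    {τ : Plane → Plane} (hτ : Differentiable ℝ τ) {t : ℝ} (ht : ∀ u, ‖fderiv ℝ τ u‖ ≤ t)
    (ht1 : t ≤ 1 / 5) {x : Signal M'} (z : Fin M' → ℝ)
    (hx : ∀ c', MemLp (fun u => x c' u - z c') 2 volume) :
    channelNorm (deform τ (convLayer σ W b x) - convLayer σ W b (deform τ x)) ≤
      ENNReal.ofReal (8 * t) * channelNorm fun c' u => x c' u - z c' := by
  have hxL : IsL2UpToConst x := fun c' => ⟨z c', hx c'⟩
  have hdL := hxL.deform hτ ht ht1
  refine channelNorm_le_of_schur hM' hrow hcol fun c => ?_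
  -- the constants commute with the deformation, so they can be subtracted
  have key : ∀ c' u, correlate (W c' c) (x c') (u - τ u) - correlate (W c' c) (deform τ x c') u =
      correlate (W c' c) (fun v => x c' v - z c') (u - τ u) -
        correlate (W c' c) (fun v => x c' (v - τ v) - z c') u := fun c' u => by
    rw [correlate_sub (hW c' c) (hxL.locallyIntegrable c') (locallyIntegrable_const (z c')),
      show (fun v => x c' (v - τ v) - z c') = fun v => deform τ x c' v - z c' from rfl,
      correlate_sub (hW c' c) (hdL.locallyIntegrable c') (locallyIntegrable_const (z c')),
      correlate_const, correlate_const]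
    ring
  refine le_trans (eLpNorm_mono fun u => ?_) (eLpNorm_sum_le_of_le
    (f := fun c' u => correlate (W c' c) (fun v => x c' v - z c') (u - τ u) -
        correlate (W c' c) (fun v => x c' (v - τ v) - z c') u)
    (fun c' => ?_) fun c' => (hW c' c).eLpNorm_correlate_deform_sub_le (hβ c' c) (hWβ c' c)
      hτ ht ht1 (hx c'))
  · have h := hσ.dist_le_mul ((∑ c', correlate (W c' c) (x c') (u - τ u)) + b c)
      ((∑ c', correlate (W c' c) (deform τ x c') u) + b c)
    rw [NNReal.coe_one, one_mul, dist_add_right, dist_eq_norm, dist_eq_norm,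
      ← Finset.sum_sub_distrib] at h
    simp only [← key]
    exact h
  · exact ((aestronglyMeasurable_correlate (hW c' c) (hx c').1).comp_quasiMeasurePreserving
      (quasiMeasurePreserving_deform hτ ht ht1)).sub
      (aestronglyMeasurable_correlate (hW c' c) (MemLp.comp_deform hτ ht ht1 (hx c')).1)

end Layer

/-! ### Deep networks -/

namespace DCFNet

/-- The bounds `π ‖a_{c',c}‖_FB` on the weighted variations of the filters of a layer. -/
noncomputable def filterBound (N : DCFNet) (l : ℕ) (c' : Fin (N.M l)) (c : Fin (N.M (l + 1))) :
    ℝ≥0∞ := ENNReal.ofReal (Real.pi * fbNorm (N.K l) (N.a l c' c))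

lemma fbNorm_nonneg (K : Finset FBIndex) (a : FBIndex → ℝ) : 0 ≤ Real.pi * fbNorm K a :=
  mul_nonneg Real.pi_pos.le (Real.sqrt_nonneg _)

lemma sum_filterBound_row_le (N : DCFNet) {l : ℕ} (h : N.coeffBound l ≤ 1)
    (c : Fin (N.M (l + 1))) : ∑ c', N.filterBound l c' c ≤ 1 := by
  unfold filterBound
  rw [← ENNReal.ofReal_sum_of_nonneg fun c' _ => fbNorm_nonneg _ _, ← ENNReal.ofReal_one,
    ← Finset.mul_sum]
  refine ENNReal.ofReal_le_ofReal (le_trans ?_ h)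
  refine mul_le_mul_of_nonneg_left (le_max_of_le_left ?_) Real.pi_pos.le
  exact le_ciSup (f := fun c => ∑ c', fbNorm (N.K l) (N.a l c' c)) (Set.finite_range _).bddAbove c

lemma sum_filterBound_col_le (N : DCFNet) {l : ℕ} (h : N.coeffBound l ≤ 1)
    (c' : Fin (N.M l)) :
    (N.M l : ℝ≥0∞) * (N.M (l + 1) : ℝ≥0∞)⁻¹ * ∑ c, N.filterBound l c' c ≤ 1 := by
  have hM : (0 : ℝ) < N.M (l + 1) := by exact_mod_cast N.M_pos (l + 1)
  unfold filterBound
  rw [← ENNReal.ofReal_sum_of_nonneg fun c _ => fbNorm_nonneg _ _, ← Finset.mul_sum,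
    ← ENNReal.ofReal_natCast, ← ENNReal.ofReal_natCast, ← ENNReal.ofReal_inv_of_pos hM,
    ← ENNReal.ofReal_mul (by positivity), ← ENNReal.ofReal_mul (by positivity),
    ← ENNReal.ofReal_one]
  refine ENNReal.ofReal_le_ofReal (le_trans (le_of_eq ?_) (le_trans
    (mul_le_mul_of_nonneg_left (le_max_of_le_right (le_ciSup (f := fun c' => (N.M l : ℝ) /
      (N.M (l + 1) : ℝ) * ∑ c, fbNorm (N.K l) (N.a l c' c)) (Set.finite_range _).bddAbove c'))
      Real.pi_pos.le) h))
  ring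

/-- The response of the network to the zero input does not depend on the position. -/
lemma output_zero_eq (N : DCFNet) (l : ℕ) (c : Fin (N.M l)) (u : Plane) :
    N.output l 0 c u = N.output l 0 c 0 := by
  induction l generalizing u with
  | zero => rfl
  | succ l ih =>
    have h : N.output l 0 = fun c _ => N.output l 0 c 0 := by
      funext c u; exact ih c u
    simp only [output]
    rw [h, convLayer_apply, convLayer_apply]
    simp only [correlate_const]

variable {N : DCFNet} {L : ℕ}

lemma memLp_output_sub (hσ : LipschitzWith 1 N.σ) (hA : ∀ l < L, N.coeffBound l ≤ 1)
    {x : Signal (N.M 0)} (hx : ∀ c, MemLp (x c) 2 volume) (l : ℕ) (hl : l ≤ L) :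
    (∀ c, MemLp (fun u => N.output l x c u - N.output l 0 c 0) 2 volume) ∧
      channelNorm (N.output l x - N.output l 0) ≤ channelNorm x := by
  induction l with
  | zero => exact ⟨fun c => by simpa [output] using hx c, by simp [output]⟩
  | succ l ih =>
    obtain ⟨h1, h2⟩ := ih (by omega)
    have hL : IsL2UpToConst (N.output l x) := fun c => ⟨_, h1 c⟩
    have h0 : IsL2UpToConst (N.output l 0) := fun c => ⟨N.output l 0 c 0, by
      simp [output_zero_eq N l c]⟩
    have h3 : channelNorm (N.output (l + 1) x - N.output (l + 1) 0) ≤ channelNorm x :=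
      (channelNorm_convLayer_sub_le hσ (N.isConvFilter_filter l) (fun _ _ => ENNReal.ofReal_ne_top)
        (N.weightedVariation_filter_le l) (N.M_pos l) (N.sum_filterBound_row_le (hA l hl))
        (N.sum_filterBound_col_le (hA l hl)) hL h0).trans h2
    refine ⟨fun c => ?_, h3⟩
    have hm : ∀ c, AEStronglyMeasurable ((N.output (l + 1) x - N.output (l + 1) 0) c) volume :=
      fun c => (aestronglyMeasurable_convLayer hσ (N.isConvFilter_filter l)
        hL.aestronglyMeasurable c).sub (aestronglyMeasurable_convLayer hσ (N.isConvFilter_filter l)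
        h0.aestronglyMeasurable c)
    have h4 := memLp_of_channelNorm_lt_top hm (h3.trans_lt (channelNorm_lt_top (N.M_pos 0) hx)) c
    have e : (N.output (l + 1) x - N.output (l + 1) 0) c =
        fun u => N.output (l + 1) x c u - N.output (l + 1) 0 c 0 := by
      funext u
      rw [← output_zero_eq N (l + 1) c u]
      rfl
    rwa [e] at h4

lemma channelNorm_deform_output_sub_le (hσ : LipschitzWith 1 N.σ)
    (hA : ∀ l < L, N.coeffBound l ≤ 1) {τ : Plane → Plane} (hτ : Differentiable ℝ τ) {t : ℝ}
    (ht : ∀ u, ‖fderiv ℝ τ u‖ ≤ t) (ht1 : t ≤ 1 / 5)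
    {x : Signal (N.M 0)} (hx : ∀ c, MemLp (x c) 2 volume) (l : ℕ) (hl : l ≤ L) :
    channelNorm (deform τ (N.output l x) - N.output l (deform τ x)) ≤
      l * ENNReal.ofReal (8 * t) * channelNorm x := by
  have hdx : ∀ c, MemLp (deform τ x c) 2 volume := fun c => MemLp.comp_deform hτ ht ht1 (hx c)
  induction l with
  | zero =>
    have e : deform τ (N.output 0 x) - N.output 0 (deform τ x) = 0 := sub_self _
    rw [e, channelNorm]
    simp
  | succ l ih =>
    obtain ⟨h1, h2⟩ := memLp_output_sub hσ hA hx l (by omega)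
    obtain ⟨h3, -⟩ := memLp_output_sub hσ hA hdx l (by omega)
    have hL : IsL2UpToConst (N.output l x) := fun c => ⟨_, h1 c⟩
    have hdL := hL.deform hτ ht ht1
    have hLd : IsL2UpToConst (N.output l (deform τ x)) := fun c => ⟨_, h3 c⟩
    have hW := N.isConvFilter_filter l
    have hm := aestronglyMeasurable_convLayer (b := N.b l) hσ hW hL.aestronglyMeasurable
    have hmd := aestronglyMeasurable_convLayer (b := N.b l) hσ hW hdL.aestronglyMeasurable
    have hdm := aestronglyMeasurable_convLayer (b := N.b l) hσ hW hLd.aestronglyMeasurable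
    have e : deform τ (N.output (l + 1) x) - N.output (l + 1) (deform τ x) =
        (deform τ (convLayer N.σ (N.filter l) (N.b l) (N.output l x)) -
          convLayer N.σ (N.filter l) (N.b l) (deform τ (N.output l x))) +
        (convLayer N.σ (N.filter l) (N.b l) (deform τ (N.output l x)) -
          convLayer N.σ (N.filter l) (N.b l) (N.output l (deform τ x))) :=
      (sub_add_sub_cancel _ _ _).symm
    have e2 : (fun c u => N.output l x c u - N.output l 0 c 0) =
        N.output l x - N.output l 0 := by
      funext c u
      rw [← output_zero_eq N l c u]
      rfl
    have k1 := channelNorm_deform_convLayer_sub_le (b := N.b l) hσ hW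
      (fun _ _ => ENNReal.ofReal_ne_top) (N.weightedVariation_filter_le l) (N.M_pos l)
      (N.sum_filterBound_row_le (hA l hl)) (N.sum_filterBound_col_le (hA l hl)) hτ ht ht1 _ h1
    rw [e2] at k1
    have k2 := channelNorm_convLayer_sub_le (b := N.b l) hσ hW
      (fun _ _ => ENNReal.ofReal_ne_top) (N.weightedVariation_filter_le l) (N.M_pos l)
      (N.sum_filterBound_row_le (hA l hl)) (N.sum_filterBound_col_le (hA l hl)) hdL hLd
    rw [e]
    refine (channelNorm_add_le (fun c => ?_) fun c => ?_).trans
      ((add_le_add (k1.trans (mul_le_mul_right h2 _)) (k2.trans (ih (by omega)))).trans_eq ?_)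
    · exact ((hm c).comp_quasiMeasurePreserving
        (quasiMeasurePreserving_deform hτ ht ht1)).sub (hmd c)
    · exact (hmd c).sub (hdm c)
    · push_cast; ring

end DCFNet

/-- Deformation stability of a DCFNet with Fourier-Bessel bases. -/
theorem theorem3p7 (N : DCFNet) (L : ℕ) (J : ℤ) (τ : Plane → Plane)
    (hτ : ContDiff ℝ 2 τ)
    (hA0_bdd : BddAbove (Set.range fun u : Plane => ‖fderiv ℝ τ u‖))
    (hA0 : gradSup τ < 1 / 5)
    (hA1 : LipschitzWith 1 N.σ)
    (hA2' : ∀ l < L, N.coeffBound l ≤ 1)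
    (x : Signal (N.M 0)) (hx : ∀ c, MemLp (x c) 2 volume) :
    (∀ c, MemLp (deform τ (N.output L x) c - N.output L (deform τ x) c) 2 volume) ∧
      signalNorm J (deform τ (N.output L x) - N.output L (deform τ x)) ≤
        8 * L * gradSup τ * signalNorm J x := by
  have hd : Differentiable ℝ τ := hτ.differentiable (by norm_num)
  have ht : ∀ u, ‖fderiv ℝ τ u‖ ≤ gradSup τ := fun u => le_ciSup hA0_bdd u
  have ht0 : 0 ≤ gradSup τ := (norm_nonneg _).trans (ht 0)
  have hdx : ∀ c, MemLp (deform τ x c) 2 volume := fun c => MemLp.comp_deform hd ht hA0.le (hx c)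
  have hxfin := channelNorm_lt_top (N.M_pos 0) hx
  have h := DCFNet.channelNorm_deform_output_sub_le hA1 hA2' hd ht hA0.le hx L le_rfl
  have hfin : (L : ℝ≥0∞) * ENNReal.ofReal (8 * gradSup τ) * channelNorm x < ∞ :=
    ENNReal.mul_lt_top (ENNReal.mul_lt_top (ENNReal.natCast_lt_top L) ENNReal.ofReal_lt_top) hxfin
  have hL : IsL2UpToConst (N.output L x) := fun c =>
    ⟨_, (DCFNet.memLp_output_sub hA1 hA2' hx L le_rfl).1 c⟩
  have hLd : IsL2UpToConst (N.output L (deform τ x)) := fun c =>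
    ⟨_, (DCFNet.memLp_output_sub hA1 hA2' hdx L le_rfl).1 c⟩
  have hmem := memLp_of_channelNorm_lt_top
    (fun c => ((hL.deform hd ht hA0.le).aestronglyMeasurable c).sub (hLd.aestronglyMeasurable c))
    (h.trans_lt hfin)
  refine ⟨hmem, ?_⟩
  rw [signalNorm_eq J (x := deform τ (N.output L x) - N.output L (deform τ x)) hmem,
    signalNorm_eq J hx, ← mul_div_assoc]
  refine div_le_div_of_nonneg_right ?_ (by positivity)
  refine (ENNReal.toReal_mono hfin.ne h).trans_eq ?_
  rw [ENNReal.toReal_mul, ENNReal.toReal_mul, ENNReal.toReal_natCast,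
    ENNReal.toReal_ofReal (by positivity)]
  ring
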